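/- Let $k$ be an algebraically closed field, let $n \ge 0$, and let $m$ be a positive integer coprime to $\operatorname{char} k$ (that is, $m \neq 0$ in $k$; no condition if $\operatorname{char} k = 0$). Let $\mathsf F_m : \mathbb P^n_k \to \mathbb P^n_k$ be the morphism $[x_0 : \dots : x_n] \mapsto [x_0^m : \dots : x_n^m]$. Let the torus $\mathbb T = \mathbb G_{m,k}^n$ act on $\mathbb P^n_k$ by $$\sigma\big((t_1,\dots,t_n),[x_0:x_1:\dots:x_n]\big) = [x_0 : t_1x_1 : \dots : t_nx_n],$$ and let $\mathcal E$ be a toric vector bundle on $\mathbb P^n_k$, i.e. a locally free sheaf of finite rank together with a linearization: an isomorphism $\varphi : \sigma^*\mathcal E \to p_2^*\mathcal E$ on $\mathbb T \times \mathbb P^n_k$ satisfying the cocycle condition $(\mu\times 1)^*\varphi = p_{23}^*\varphi\circ(1\times\sigma)^*\varphi$ on $\mathbb T\times\mathbb T\times\mathbb P^n_k$, where $\mu$ is the multiplication of $\mathbb T$ and $p_2$, $p_{23}$ are the projections. Let $G = \mu_m^n = \{t \in \mathbb T(k) : t_i^m = 1 \text{ for all } i\}$. Since $\mathsf F_m(gx)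 = \mathsf F_m(x)$ for $g \in G$, every $g \in G$ acts on $\mathsf F_{m*}\mathcal E$: a section $s$ of $\mathcal E$ over $\mathsf F_m^{-1}(U)$ is sent to $g\cdot s$, where $(g\cdot s)(x) = \varphi_{(g,x)}(s(gx))$. Then the following hold. 1. This is an action of the group $G$ on $\mathsf F_{m*}\mathcal E$ by $\mathcal O_{\mathbb P^n}$-linear automorphisms, and $G$ has exactly $m^n$ characters $\chi : G \to k^\times$. 2. $\mathsf F_{m*}\mathcal E = \bigoplus_{\chi \in \operatorname{Hom}(G,k^\times)} \mathcal E_\chi$, where $\mathcal E_\chi \subseteq \mathsf F_{m*}\mathcal E$ is the isotypic component of $\chi$: for every open $U \subseteq \mathbb P^n_k$, $$\mathcal E_\chi(U) = \{ s \in (\mathsf F_{m*}\mathcal E)(U) : g\cdot s = \chi(g)\, s \text{ for all } g \in G\}.$$ 3. $\mathcal E$ has a constant rank, and each of the $m^n$ sheaves $\mathcal E_\chi$ is a vector bundle with $\operatorname{rk}\mathcal E_\chi = \operatorname{rk}\mathcal E$. -/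

import Mathlib

open CategoryTheory AlgebraicGeometry

universe u

namespace ToricFrobenius

open HomogeneousLocalization

section DegreeScaling

variable {A B C : Type u} {σ τ ψ : Type u} [CommRing A] [CommRing B] [CommRing C]
  [SetLike σ A] [AddSubgroupClass σ A] [SetLike τ B] [AddSubgroupClass τ B]
  [SetLike ψ C] [AddSubgroupClass ψ C]

/-- A ring homomorphism `f` between graded rings which multiplies all degrees by `d > 0` and is
nowhere vanishing: every point of `Proj ℬ` lies in `D₊(f s)` for some homogeneous `s` of positive
degree. Such an `f` induces a morphism `Proj ℬ ⟶ Proj 𝒜`. -/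
structure IsScaling (𝒜 : ℕ → σ) (ℬ : ℕ → τ) [GradedRing 𝒜] [GradedRing ℬ]
    (d : ℕ) (f : A →+* B) : Prop where
  pos : 0 < d
  map_mem : ∀ (i : ℕ) (a : A), a ∈ 𝒜 i → f a ∈ ℬ (d * i)
  exists_notMem : ∀ x : ProjectiveSpectrum ℬ, ∃ (i : ℕ) (s : A), 0 < i ∧ s ∈ 𝒜 i ∧
    f s ∉ x.asHomogeneousIdeal

variable {𝒜 : ℕ → σ} {ℬ : ℕ → τ} {𝒞 : ℕ → ψ} [GradedRing 𝒜] [GradedRing ℬ] [GradedRing 𝒞]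
  {d e : ℕ} {f : A →+* B} {g : B →+* C}

/-- The map `A_s → B_{f(s)}` of localizations induced by `f`. -/
noncomputable def locMap (f : A →+* B) (s : A) :
    Localization.Away s →+* Localization.Away (f s) :=
  IsLocalization.map (Localization.Away (f s)) f
    (show Submonoid.powers s ≤ (Submonoid.powers (f s)).comap f by
      rintro _ ⟨j, rfl⟩
      exact ⟨j, by simp⟩)

lemma exists_val_eq_locMap (hf : IsScaling 𝒜 ℬ d f) (s : A) (z : Away 𝒜 s) :
    ∃ w : Away ℬ (f s), w.val = locMap f s z.val := by
  obtain ⟨⟨i, ⟨a, ha⟩, ⟨b, hb'⟩, j, rfl : _ = b⟩, rfl⟩ := mk_surjective z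
  refine ⟨mk ⟨d * i, ⟨f a, hf.map_mem _ _ ha⟩, ⟨f (s ^ j), hf.map_mem _ _ hb'⟩,
    ⟨j, (map_pow f s j).symm⟩⟩, ?_⟩
  simp only [val_mk, locMap, Localization.mk_eq_mk', IsLocalization.map_mk']

/-- A degree-scaling homomorphism `f` induces the maps
`(A_s)₀ → (B_{f(s)})₀`, `a / s ^ j ↦ f(a) / f(s) ^ j`. -/
noncomputable def awayScale (hf : IsScaling 𝒜 ℬ d f) (s : A) : Away 𝒜 s →+* Away ℬ (f s) where
  toFun z := (exists_val_eq_locMap hf s z).choose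
  map_one' := val_injective _ <| by
    rw [(exists_val_eq_locMap hf s 1).choose_spec]; simp
  map_zero' := val_injective _ <| by
    rw [(exists_val_eq_locMap hf s 0).choose_spec]; simp
  map_add' x y := val_injective _ <| by
    rw [(exists_val_eq_locMap hf s (x + y)).choose_spec, val_add, val_add,
      (exists_val_eq_locMap hf s x).choose_spec, (exists_val_eq_locMap hf s y).choose_spec, map_add]
  map_mul' x y := val_injective _ <| by
    rw [(exists_val_eq_locMap hf s (x * y)).choose_spec, val_mul, val_mul,
      (exists_val_eq_locMap hf s x).choose_spec, (exists_val_eq_locMap hf s y).choose_spec, map_mul]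

lemma val_awayScale (hf : IsScaling 𝒜 ℬ d f) (s : A) (z : Away 𝒜 s) :
    (awayScale hf s z).val = locMap f s z.val :=
  (exists_val_eq_locMap hf s z).choose_spec

lemma awayScale_comp_awayMap (hf : IsScaling 𝒜 ℬ d f) {i : ℕ} (s t : A) (ht : t ∈ 𝒜 i)
    {x : A} (hx : x = s * t) (hx' : f x = f s * f t) :
    (awayScale hf x).comp (awayMap 𝒜 ht hx) =
      (awayMap ℬ (hf.map_mem _ _ ht) hx').comp (awayScale hf s) := by
  ext z
  simp only [RingHom.comp_apply, val_awayScale, val_awayMap]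
  generalize z.val = w
  simp only [← RingHom.comp_apply]
  congr 1
  apply IsLocalization.ringHom_ext (M := Submonoid.powers s)
  ext a
  simp [locMap, Localization.awayLift]

lemma awayScale_comp (hf : IsScaling 𝒜 ℬ d f) (hg : IsScaling ℬ 𝒞 e g) {d' : ℕ}
    (hh : IsScaling 𝒜 𝒞 d' (g.comp f)) (s : A) :
    (awayScale hg (f s)).comp (awayScale hf s) = awayScale hh s := by
  ext z
  refine (val_awayScale hg (f s) (awayScale hf s z)).trans ?_
  refine Eq.trans ?_ (val_awayScale hh s z).symm
  rw [val_awayScale]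
  generalize z.val = w
  induction w using Localization.induction_on with
  | _ p => simp [locMap, Localization.mk_eq_mk', IsLocalization.map_mk']

lemma awayScale_id (hf : IsScaling 𝒜 𝒜 1 (RingHom.id A)) (s : A) :
    awayScale hf s = RingHom.id (Away 𝒜 s) := by
  ext z
  refine (val_awayScale hf s z).trans ?_
  simp only [RingHom.id_apply]
  generalize z.val = w
  induction w using Localization.induction_on with
  | _ p => simp [locMap, Localization.mk_eq_mk', IsLocalization.map_mk']

/-- The affine open cover of `Proj ℬ` by the `D₊(f s)`, for `s` homogeneous of positive degree. -/
noncomputable def scaleCover (hf : IsScaling 𝒜 ℬ d f) : (Proj ℬ).AffineOpenCover where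
  I₀ := Σ i : PNat, 𝒜 i
  X s := .of (Away ℬ (f s.2))
  f s := Proj.awayι ℬ (f s.2) (hf.map_mem _ _ s.2.2) (Nat.mul_pos hf.pos s.1.2)
  idx x := ⟨⟨(hf.exists_notMem x).choose, (hf.exists_notMem x).choose_spec.choose_spec.1⟩,
    ⟨(hf.exists_notMem x).choose_spec.choose, (hf.exists_notMem x).choose_spec.choose_spec.2.1⟩⟩
  covers x := by
    change x ∈ (Proj.awayι ℬ _ _ _).opensRange
    rw [Proj.opensRange_awayι]
    exact (hf.exists_notMem x).choose_spec.choose_spec.2.2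

lemma awayScale_compat (hf : IsScaling 𝒜 ℬ d f) {i j : ℕ} (hi : 0 < i) (hj : 0 < j) (s t : A)
    (hs : s ∈ 𝒜 i) (ht : t ∈ 𝒜 j) :
    Limits.pullback.fst
        (Proj.awayι ℬ (f s) (hf.map_mem _ _ hs) (Nat.mul_pos hf.pos hi))
        (Proj.awayι ℬ (f t) (hf.map_mem _ _ ht) (Nat.mul_pos hf.pos hj)) ≫
        Spec.map (CommRingCat.ofHom (awayScale hf s)) ≫ Proj.awayι 𝒜 s hs hi =
      Limits.pullback.snd _ _ ≫
        Spec.map (CommRingCat.ofHom (awayScale hf t)) ≫ Proj.awayι 𝒜 t ht hj := by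
  have hx : f (s * t) = f s * f t := map_mul f s t
  rw [← cancel_epi (Proj.pullbackAwayιIso ℬ (hf.map_mem _ _ hs) (Nat.mul_pos hf.pos hi)
    (hf.map_mem _ _ ht) (Nat.mul_pos hf.pos hj) hx).inv,
    Proj.pullbackAwayιIso_inv_fst_assoc, Proj.pullbackAwayιIso_inv_snd_assoc]
  simp only [← Spec.map_comp_assoc, ← CommRingCat.ofHom_comp]
  rw [← awayScale_comp_awayMap hf s t ht rfl hx,
    ← awayScale_comp_awayMap hf t s hs (mul_comm s t) (hx.trans (mul_comm _ _))]
  simp only [CommRingCat.ofHom_comp, Spec.map_comp, Category.assoc]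
  rw [Proj.SpecMap_awayMap_awayι, Proj.SpecMap_awayMap_awayι]
  rfl

/-- The morphism `Proj ℬ ⟶ Proj 𝒜` induced by a degree-scaling homomorphism, glued from the
maps `Spec (B_{f(s)})₀ ⟶ Spec (A_s)₀`. -/
noncomputable def projScale (hf : IsScaling 𝒜 ℬ d f) : Proj ℬ ⟶ Proj 𝒜 :=
  (scaleCover hf).openCover.glueMorphisms
    (fun s ↦ Spec.map (CommRingCat.ofHom (awayScale hf s.2.1)) ≫
      Proj.awayι 𝒜 s.2.1 s.2.2 s.1.2)
    fun s t ↦ awayScale_compat hf s.1.2 t.1.2 _ _ s.2.2 t.2.2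

/-- On the standard charts, `projScale` is `Spec` of `a / s ^ j ↦ f(a) / f(s) ^ j`. -/
lemma awayι_projScale (hf : IsScaling 𝒜 ℬ d f) {i : ℕ} (hi : 0 < i) (s : A) (hs : s ∈ 𝒜 i) :
    Proj.awayι ℬ (f s) (hf.map_mem _ _ hs) (Nat.mul_pos hf.pos hi) ≫ projScale hf =
      Spec.map (CommRingCat.ofHom (awayScale hf s)) ≫ Proj.awayι 𝒜 s hs hi :=
  (scaleCover hf).openCover.ι_glueMorphisms _ _ ⟨⟨i, hi⟩, ⟨s, hs⟩⟩

lemma projScale_comp (hf : IsScaling 𝒜 ℬ d f) (hg : IsScaling ℬ 𝒞 e g) {d' : ℕ} {h : A →+* C}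
    (hh : IsScaling 𝒜 𝒞 d' h) (H : h = g.comp f) :
    projScale hg ≫ projScale hf = projScale hh := by
  subst H
  have key {i : ℕ} (hi : 0 < i) (s : A) (hs : s ∈ 𝒜 i) :
      Proj.awayι 𝒞 (g (f s)) (hh.map_mem _ _ hs) (Nat.mul_pos hh.pos hi) ≫
        projScale hg ≫ projScale hf =
      Spec.map (CommRingCat.ofHom (awayScale hh s)) ≫ Proj.awayι 𝒜 s hs hi := by
    have h1 := awayι_projScale hg (Nat.mul_pos hf.pos hi) (f s) (hf.map_mem _ _ hs)
    have h2 := (reassoc_of% h1) (projScale hf)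
    rw [awayι_projScale hf hi s hs, ← Spec.map_comp_assoc, ← CommRingCat.ofHom_comp,
      awayScale_comp hf hg hh] at h2
    exact h2
  refine (scaleCover hh).openCover.hom_ext _ _ fun s ↦ ?_
  exact (key s.1.2 s.2.1 s.2.2).trans (awayι_projScale hh s.1.2 s.2.1 s.2.2).symm

lemma projScale_id {f : A →+* A} (hf : IsScaling 𝒜 𝒜 1 f) (h : f = RingHom.id A) :
    projScale hf = 𝟙 (Proj 𝒜) := by
  subst h
  have key {i : ℕ} (hi : 0 < i) (s : A) (hs : s ∈ 𝒜 i) :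
      Proj.awayι 𝒜 s (hf.map_mem _ _ hs) (Nat.mul_pos hf.pos hi) ≫ projScale hf =
      Proj.awayι 𝒜 s (hf.map_mem _ _ hs) (Nat.mul_pos hf.pos hi) := by
    have h2 := awayι_projScale hf hi s hs
    rw [awayScale_id] at h2
    exact h2.trans (by rw [CommRingCat.ofHom_id, Spec.map_id]; exact Category.id_comp _)
  refine (scaleCover hf).openCover.hom_ext _ _ fun s ↦ ?_
  exact (key s.1.2 s.2.1 s.2.2).trans (Category.comp_id _).symm

end DegreeScaling

section ProjectiveSpace

open MvPolynomial

attribute [local instance] MvPolynomial.gradedAlgebra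

/-- Projective `n`-space over a commutative ring `R`, that is `Proj R[x₀, …, xₙ]`. For `R` the
coordinate ring of an affine `k`-scheme `T`, this is the product `T × ℙⁿ` over `k`. -/
noncomputable def ProjSpace (n : ℕ) (R : Type u) [CommRing R] : Scheme.{u} :=
  Proj (homogeneousSubmodule (Fin (n + 1)) R)

/-- The structure morphism `ℙⁿ_R ⟶ Spec R`. -/
noncomputable def ProjSpace.toSpec (n : ℕ) (R : Type u) [CommRing R] :
    ProjSpace n R ⟶ Spec (.of R) :=
  Proj.toSpecZero (homogeneousSubmodule (Fin (n + 1)) R) ≫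
    Spec.map (CommRingCat.ofHom (algebraMap R (homogeneousSubmodule (Fin (n + 1)) R 0)))

/-- A constant `c : R`, as a regular function on the open subset `U` of `ℙⁿ_R`. -/
noncomputable def ProjSpace.const {n : ℕ} {R : Type u} [CommRing R] (c : R)
    (U : (ProjSpace n R).Opens) : Γ(ProjSpace n R, U) :=
  (ProjSpace n R).presheaf.map (homOfLE le_top).op
    ((ProjSpace.toSpec n R).appTop ((Scheme.ΓSpecIso (.of R)).inv c))

variable {n : ℕ} {R R' R'' : Type u} [CommRing R] [CommRing R'] [CommRing R'']

/-- The homomorphism `R[x₀, …, xₙ] → R'[x₀, …, xₙ]` given by `φ` on coefficients and by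
`x₀ ↦ x₀ ^ m` and `xᵢ ↦ tᵢ xᵢ ^ m` for `i = 1, …, n`. -/
noncomputable def coordHom (φ : R →+* R') (t : Fin n → R'ˣ) (m : ℕ) :
    MvPolynomial (Fin (n + 1)) R →+* MvPolynomial (Fin (n + 1)) R' :=
  eval₂Hom (C.comp φ)
    (fun i ↦ C ((Fin.cons 1 t : Fin (n + 1) → R'ˣ) i : R') * X i ^ m)

lemma coordHom_isScaling (φ : R →+* R') (t : Fin n → R'ˣ) {m : ℕ} (hm : 0 < m) :
    IsScaling (homogeneousSubmodule (Fin (n + 1)) R) (homogeneousSubmodule (Fin (n + 1)) R') m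
      (coordHom φ t m) where
  pos := hm
  map_mem i a ha := by
    rw [mem_homogeneousSubmodule] at ha ⊢
    refine ha.eval₂ _ _ (fun r ↦ isHomogeneous_C _ _) fun j ↦ ?_
    simpa using (isHomogeneous_C (Fin (n + 1)) _).mul ((isHomogeneous_X R' j).pow m)
  exists_notMem x := by
    have hx : ∃ j : Fin (n + 1), (X j : MvPolynomial (Fin (n + 1)) R') ∉ x.asHomogeneousIdeal := by
      by_contra! H
      refine x.not_irrelevant_le fun p hp ↦ ?_
      have h0 : p ∈ Ideal.span (X '' (Set.univ : Set (Fin (n + 1)))) := by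
        rw [mem_ideal_span_X_image]
        intro e he
        have h1 : homogeneousComponent 0 p = 0 := by
          have := (HomogeneousIdeal.mem_irrelevant_iff _ _).mp hp
          rw [GradedRing.proj_apply] at this
          rw [← decomposition.decompose'_apply]
          exact this
        rw [homogeneousComponent_zero, C_eq_zero] at h1
        by_contra! H0
        obtain rfl : e = 0 := Finsupp.ext fun j ↦ H0 j (Set.mem_univ j)
        exact mem_support_iff.mp he h1
      have : Ideal.span (X '' (Set.univ : Set (Fin (n + 1)))) ≤ x.asHomogeneousIdeal.toIdeal := by
        rw [Ideal.span_le]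
        rintro _ ⟨j, -, rfl⟩
        exact H j
      exact this h0
    obtain ⟨j, hj⟩ := hx
    refine ⟨1, X j, one_pos, isHomogeneous_X R j, fun hmem ↦ hj ?_⟩
    have hp := x.isPrime
    have h1 : (C ((Fin.cons 1 t : Fin (n + 1) → R'ˣ) j : R') * X j ^ m :
        MvPolynomial (Fin (n + 1)) R') ∈ x.asHomogeneousIdeal.toIdeal := by
      simpa [coordHom] using hmem
    have hu : IsUnit (C ((Fin.cons 1 t : Fin (n + 1) → R'ˣ) j : R') :
        MvPolynomial (Fin (n + 1)) R') := (Units.isUnit _).map C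
    exact hp.mem_of_pow_mem _ ((Ideal.unit_mul_mem_iff_mem _ hu).mp h1)

/-- The morphism `ℙⁿ_{R'} ⟶ ℙⁿ_R` which lies over `φ : R → R'` and is given by
`[x₀ : x₁ : … : xₙ] ↦ [x₀ ^ m : t₁ x₁ ^ m : … : tₙ xₙ ^ m]`. -/
noncomputable def coordMap (φ : R →+* R') (t : Fin n → R'ˣ) (m : ℕ) (hm : 0 < m) :
    ProjSpace n R' ⟶ ProjSpace n R :=
  projScale (coordHom_isScaling φ t hm)

lemma coordMap_comp (φ : R →+* R') (t : Fin n → R'ˣ) (m : ℕ) (hm : 0 < m)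
    (φ' : R' →+* R'') (t' : Fin n → R''ˣ) (m' : ℕ) (hm' : 0 < m')
    (φ'' : R →+* R'') (t'' : Fin n → R''ˣ) (m'' : ℕ) (hm'' : 0 < m'')
    (hφ : ∀ r, φ'' r = φ' (φ r)) (ht : ∀ i, (t'' i : R'') = φ' (t i) * t' i ^ m)
    (hmm : m'' = m' * m) :
    coordMap φ' t' m' hm' ≫ coordMap φ t m hm = coordMap φ'' t'' m'' hm'' := by
  refine projScale_comp _ _ _ ?_
  refine MvPolynomial.ringHom_ext (fun r ↦ ?_) fun i ↦ ?_
  · simp [coordHom, hφ]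
  · refine Fin.cases ?_ (fun i ↦ ?_) i
    · simp [coordHom, hmm, pow_mul]
    · simp [coordHom, hmm, pow_mul, ht, mul_pow, mul_assoc]

lemma coordMap_id (φ : R →+* R) (t : Fin n → Rˣ) (hφ : ∀ r, φ r = r) (ht : ∀ i, (t i : R) = 1) :
    coordMap φ t 1 one_pos = 𝟙 (ProjSpace n R) := by
  refine projScale_id _ ?_
  refine MvPolynomial.ringHom_ext (fun r ↦ ?_) fun i ↦ ?_
  · simp [coordHom, hφ]
  · refine Fin.cases ?_ (fun i ↦ ?_) i
    · simp [coordHom]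
    · simp [coordHom, ht]

end ProjectiveSpace

section Modules

open Scheme.Modules

/-- The free `𝒪_X`-module `𝒪_X ^ r`. -/
noncomputable def freeModule (X : Scheme.{u}) (r : ℕ) : X.Modules :=
  SheafOfModules.free (R := X.ringCatSheaf) (ULift.{u} (Fin r))

/-- `M` is a vector bundle: it is locally free of finite rank. -/
def IsVectorBundle {X : Scheme.{u}} (M : X.Modules) : Prop :=
  ∀ x : X, ∃ (U : X.Opens) (r : ℕ), x ∈ U ∧
    Nonempty (M.restrict U.ι ≅ freeModule U.toScheme r)

/-- `M` is a vector bundle of constant rank `r`. -/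
def IsVectorBundleOfRank {X : Scheme.{u}} (M : X.Modules) (r : ℕ) : Prop :=
  ∀ x : X, ∃ U : X.Opens, x ∈ U ∧
    Nonempty (M.restrict U.ι ≅ freeModule U.toScheme r)

/-- For `h : Z ⟶ X`, `a b : X ⟶ Y` and `φ : a^* M ⟶ b^* M`, the pullback `h^* φ`, seen as a
morphism `(a ∘ h)^* M ⟶ (b ∘ h)^* M`. -/
noncomputable def pullbackHom {X Y Z : Scheme.{u}} (h : Z ⟶ X) {a b : X ⟶ Y} {M : Y.Modules}
    (φ : (pullback a).obj M ⟶ (pullback b).obj M) :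
    (pullback (h ≫ a)).obj M ⟶ (pullback (h ≫ b)).obj M :=
  (pullbackComp h a).inv.app M ≫ (pullback h).map φ ≫ (pullbackComp h b).hom.app M

/-- The canonical isomorphism `a^* M ⟶ b^* M` for equal morphisms `a = b`. -/
noncomputable def pullbackEq {X Y : Scheme.{u}} {a b : X ⟶ Y} (h : a = b) (M : Y.Modules) :
    (pullback a).obj M ⟶ (pullback b).obj M :=
  (pullbackCongr h).hom.app M

end Modules

section Torus

variable (n : ℕ) (k : Type u) [Field k]

/-- The coordinate ring `k[u₁^±1, …, uₙ^±1]` of the `n`-dimensional torus `𝕋` over `k`. -/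
abbrev TorusRing : Type u := AddMonoidAlgebra k (Fin n → ℤ)

/-- The coordinate ring of `𝕋 × 𝕋`. -/
abbrev TorusRing₂ : Type u := TensorProduct k (TorusRing n k) (TorusRing n k)

variable {n}

/-- The coordinate function `uᵢ` on `𝕋`. -/
noncomputable def torusCoord (i : Fin n) : (TorusRing n k)ˣ :=
  Units.map (AddMonoidAlgebra.of k (Fin n → ℤ)) (toUnits (Multiplicative.ofAdd (Pi.single i 1)))

variable (n)

/-- The comorphism of the multiplication `𝕋 × 𝕋 ⟶ 𝕋`, given by `uᵢ ↦ uᵢ ⊗ uᵢ`. -/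
noncomputable def torusComul : TorusRing n k →+* TorusRing₂ n k :=
  (Bialgebra.comulAlgHom k (TorusRing n k)).toRingHom

/-- The comorphism of the first projection `𝕋 × 𝕋 ⟶ 𝕋`. -/
noncomputable def torusInl : TorusRing n k →+* TorusRing₂ n k :=
  (Algebra.TensorProduct.includeLeft : TorusRing n k →ₐ[k] TorusRing₂ n k).toRingHom

/-- The comorphism of the second projection `𝕋 × 𝕋 ⟶ 𝕋`. -/
noncomputable def torusInr : TorusRing n k →+* TorusRing₂ n k :=
  (Algebra.TensorProduct.includeRight : TorusRing n k →ₐ[k] TorusRing₂ n k).toRingHom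

/-- The action `σ : 𝕋 × ℙⁿ ⟶ ℙⁿ`,
`((t₁, …, tₙ), [x₀ : x₁ : … : xₙ]) ↦ [x₀ : t₁ x₁ : … : tₙ xₙ]`. -/
noncomputable def act : ProjSpace n (TorusRing n k) ⟶ ProjSpace n k :=
  coordMap (algebraMap k (TorusRing n k)) (torusCoord k) 1 one_pos

/-- The second projection `p₂ : 𝕋 × ℙⁿ ⟶ ℙⁿ`. -/
noncomputable def proj₂ : ProjSpace n (TorusRing n k) ⟶ ProjSpace n k :=
  coordMap (algebraMap k (TorusRing n k)) 1 1 one_pos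

/-- The morphism `μ × 1 : 𝕋 × 𝕋 × ℙⁿ ⟶ 𝕋 × ℙⁿ`, `(s, t, x) ↦ (s t, x)`. -/
noncomputable def mulMap : ProjSpace n (TorusRing₂ n k) ⟶ ProjSpace n (TorusRing n k) :=
  coordMap (torusComul n k) 1 1 one_pos

/-- The morphism `1 × σ : 𝕋 × 𝕋 × ℙⁿ ⟶ 𝕋 × ℙⁿ`, `(s, t, x) ↦ (s, t x)`. -/
noncomputable def actMap : ProjSpace n (TorusRing₂ n k) ⟶ ProjSpace n (TorusRing n k) :=
  coordMap (torusInl n k) (fun i ↦ Units.map (torusInr n k).toMonoidHom (torusCoord k i)) 1 one_pos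

/-- The projection `p₂₃ : 𝕋 × 𝕋 × ℙⁿ ⟶ 𝕋 × ℙⁿ`, `(s, t, x) ↦ (t, x)`. -/
noncomputable def proj₂₃ : ProjSpace n (TorusRing₂ n k) ⟶ ProjSpace n (TorusRing n k) :=
  coordMap (torusInr n k) 1 1 one_pos

lemma torusComul_coord (i : Fin n) : torusComul n k (torusCoord k i : TorusRing n k) =
    torusInl n k (torusCoord k i : TorusRing n k) *
      torusInr n k (torusCoord k i : TorusRing n k) := by
  simp [torusComul, torusInl, torusInr, torusCoord]

lemma torusComul_algebraMap (r : k) : algebraMap k (TorusRing₂ n k) r =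
    torusComul n k (algebraMap k (TorusRing n k) r) :=
  ((Bialgebra.comulAlgHom k (TorusRing n k)).commutes r).symm

lemma torusInl_algebraMap (r : k) : algebraMap k (TorusRing₂ n k) r =
    torusInl n k (algebraMap k (TorusRing n k) r) :=
  ((Algebra.TensorProduct.includeLeft : TorusRing n k →ₐ[k] TorusRing₂ n k).commutes r).symm

lemma torusInr_algebraMap (r : k) : algebraMap k (TorusRing₂ n k) r =
    torusInr n k (algebraMap k (TorusRing n k) r) :=
  ((Algebra.TensorProduct.includeRight : TorusRing n k →ₐ[k] TorusRing₂ n k).commutes r).symm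

/-- `(s t) x = s (t x)`. -/
lemma mulMap_act : mulMap n k ≫ act n k = actMap n k ≫ act n k := by
  rw [act, mulMap, actMap,
    coordMap_comp _ _ _ one_pos _ _ _ one_pos (algebraMap k (TorusRing₂ n k))
      (fun i ↦ Units.map (torusComul n k).toMonoidHom (torusCoord k i)) 1 one_pos
      (torusComul_algebraMap n k) (fun i ↦ by simp) rfl,
    coordMap_comp _ _ _ one_pos _ _ _ one_pos (algebraMap k (TorusRing₂ n k))
      (fun i ↦ Units.map (torusComul n k).toMonoidHom (torusCoord k i)) 1 one_pos
      (torusInl_algebraMap n k)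
      (fun i ↦ by simpa using torusComul_coord n k i) rfl]

/-- `p₂ ∘ (1 × σ) = σ ∘ p₂₃`. -/
lemma actMap_proj₂ : actMap n k ≫ proj₂ n k = proj₂₃ n k ≫ act n k := by
  rw [act, proj₂, proj₂₃, actMap,
    coordMap_comp _ _ _ one_pos _ _ _ one_pos (algebraMap k (TorusRing₂ n k))
      (fun i ↦ Units.map (torusInr n k).toMonoidHom (torusCoord k i)) 1 one_pos
      (torusInl_algebraMap n k) (fun i ↦ by simp) rfl,
    coordMap_comp _ _ _ one_pos _ _ _ one_pos (algebraMap k (TorusRing₂ n k))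
      (fun i ↦ Units.map (torusInr n k).toMonoidHom (torusCoord k i)) 1 one_pos
      (torusInr_algebraMap n k) (fun i ↦ by simp) rfl]

/-- `p₂ ∘ p₂₃ = p₂ ∘ (μ × 1)`. -/
lemma proj₂₃_proj₂ : proj₂₃ n k ≫ proj₂ n k = mulMap n k ≫ proj₂ n k := by
  rw [proj₂, proj₂₃, mulMap,
    coordMap_comp _ _ _ one_pos _ _ _ one_pos (algebraMap k (TorusRing₂ n k)) 1 1 one_pos
      (torusInr_algebraMap n k) (fun i ↦ by simp) rfl,
    coordMap_comp _ _ _ one_pos _ _ _ one_pos (algebraMap k (TorusRing₂ n k)) 1 1 one_pos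
      (torusComul_algebraMap n k) (fun i ↦ by simp) rfl]

variable {n k}

/-- A linearization of an `𝒪`-module `E` on `ℙⁿ` for the action of `𝕋`: an isomorphism
`φ : σ^* E ≅ p₂^* E` on `𝕋 × ℙⁿ` satisfying the cocycle condition
`(μ × 1)^* φ = p₂₃^* φ ∘ (1 × σ)^* φ` on `𝕋 × 𝕋 × ℙⁿ`. -/
structure Linearization (E : (ProjSpace n k).Modules) where
  iso : (Scheme.Modules.pullback (act n k)).obj E ≅ (Scheme.Modules.pullback (proj₂ n k)).obj E
  cocycle : pullbackHom (mulMap n k) iso.hom =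
    pullbackEq (mulMap_act n k) E ≫ pullbackHom (actMap n k) iso.hom ≫
      pullbackEq (actMap_proj₂ n k) E ≫ pullbackHom (proj₂₃ n k) iso.hom ≫
        pullbackEq (proj₂₃_proj₂ n k) E

/-- Evaluation of regular functions on `𝕋` at the `k`-point `g`. -/
noncomputable def torusEval (g : Fin n → kˣ) : TorusRing n k →+* k :=
  (AddMonoidAlgebra.lift k k (Fin n → ℤ)
    { toFun := fun a ↦ ((∏ i, g i ^ (Multiplicative.toAdd a i) : kˣ) : k)
      map_one' := by simp
      map_mul' := fun a b ↦ by simp [zpow_add, Finset.prod_mul_distrib] }).toRingHom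

lemma torusEval_coord (g : Fin n → kˣ) (i : Fin n) :
    torusEval g (torusCoord k i : TorusRing n k) = g i := by
  simp [torusEval, torusCoord, Pi.single_apply]

/-- The morphism `ℙⁿ ⟶ 𝕋 × ℙⁿ`, `x ↦ (g, x)`, for a `k`-point `g` of `𝕋`. -/
noncomputable def slice (g : Fin n → kˣ) : ProjSpace n k ⟶ ProjSpace n (TorusRing n k) :=
  coordMap (torusEval g) 1 1 one_pos

/-- The automorphism `x ↦ g x` of `ℙⁿ` for a `k`-point `g` of `𝕋`. -/
noncomputable def translate (g : Fin n → kˣ) : ProjSpace n k ⟶ ProjSpace n k :=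
  coordMap (RingHom.id k) g 1 one_pos

lemma slice_act (g : Fin n → kˣ) : slice g ≫ act n k = translate g := by
  exact coordMap_comp _ _ _ one_pos _ _ _ one_pos _ _ 1 one_pos
    (fun r ↦ by simp [torusEval]) (fun i ↦ by simp [torusEval_coord]) rfl

lemma slice_proj₂ (g : Fin n → kˣ) : slice g ≫ proj₂ n k = 𝟙 _ := by
  rw [slice, proj₂, coordMap_comp _ _ _ one_pos _ _ _ one_pos (RingHom.id k) 1 1 one_pos
    (fun r ↦ by simp [torusEval]) (fun i ↦ by simp) rfl]
  exact coordMap_id _ _ (fun _ ↦ rfl) (fun _ ↦ rfl)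

/-- The isomorphism `g^* E ⟶ E` which a linearization of `E` provides for a `k`-point `g` of `𝕋`:
the restriction of the linearization to `{g} × ℙⁿ`. -/
noncomputable def Linearization.atPoint {E : (ProjSpace n k).Modules} (L : Linearization E)
    (g : Fin n → kˣ) : (Scheme.Modules.pullback (translate g)).obj E ⟶ E :=
  pullbackEq (slice_act g).symm E ≫ pullbackHom (slice g) L.iso.hom ≫
    pullbackEq (slice_proj₂ g) E ≫ (Scheme.Modules.pullbackId (ProjSpace n k)).hom.app E

variable (n k) in
/-- The toric Frobenius morphism `𝖥ₘ : ℙⁿ ⟶ ℙⁿ`, `[x₀ : … : xₙ] ↦ [x₀ ^ m : … : xₙ ^ m]`. -/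
noncomputable def toricFrobenius (m : ℕ) (hm : 0 < m) : ProjSpace n k ⟶ ProjSpace n k :=
  coordMap (RingHom.id k) 1 m hm

variable (n k) in
/-- The group `G = μₘⁿ` of `k`-points `(t₁, …, tₙ)` of `𝕋` with `tᵢ ^ m = 1`. -/
abbrev MuPow (m : ℕ) : Type u := Fin n → rootsOfUnity m k

/-- An element of `μₘⁿ` as a `k`-point of `𝕋`. -/
def MuPow.toPoint {m : ℕ} (g : MuPow n k m) : Fin n → kˣ := fun i ↦ (g i : kˣ)

lemma translate_toricFrobenius {m : ℕ} (hm : 0 < m) (g : MuPow n k m) :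
    translate g.toPoint ≫ toricFrobenius n k m hm = toricFrobenius n k m hm := by
  refine coordMap_comp _ _ _ hm _ _ _ one_pos _ _ m hm (fun r ↦ rfl) (fun i ↦ ?_)
    (one_mul m).symm
  have h : ((g i : kˣ) : k) ^ m = 1 := (mem_rootsOfUnity' m _).mp (g i).2
  simpa [MuPow.toPoint] using h.symm

/-- The action of `g ∈ μₘⁿ` on `𝖥ₘ_* E` induced by a linearization of `E`: a section `s` of `E` on
`𝖥ₘ⁻¹ U` is pulled back along `x ↦ g x`, which maps `𝖥ₘ⁻¹ U` to itself, to a section of `g^* E`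
and then mapped to a section of `E` by the linearization. -/
noncomputable def Linearization.muAction {E : (ProjSpace n k).Modules} (L : Linearization E)
    {m : ℕ} (hm : 0 < m) (g : MuPow n k m) :
    (Scheme.Modules.pushforward (toricFrobenius n k m hm)).obj E ⟶
      (Scheme.Modules.pushforward (toricFrobenius n k m hm)).obj E :=
  (Scheme.Modules.pushforward (toricFrobenius n k m hm)).map
      ((Scheme.Modules.pullbackPushforwardAdjunction (translate g.toPoint)).unit.app E ≫
        (Scheme.Modules.pushforward (translate g.toPoint)).map (L.atPoint g.toPoint)) ≫
    (Scheme.Modules.pushforwardComp (translate g.toPoint) (toricFrobenius n k m hm)).hom.app E ≫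
    (Scheme.Modules.pushforwardCongr (translate_toricFrobenius hm g)).hom.app E

end Torus

end ToricFrobenius

open ToricFrobenius

/-!
Write `F` for the toric Frobenius morphism and `G = μₘⁿ`.

*The action.* For a `k`-point `g` of the torus, the linearization restricts to an isomorphism
`g^* E ≅ E`, and the cocycle condition, restricted to a pair of points, says that these isomorphisms
are multiplicative (`restrict_cocycle`). Taking transposes `E ⟶ g_* E` and pushing forward along
`F = F ∘ g` turns this into `Linearization.muAction_mul`; the unit acts by an idempotent isomorphism
and hence trivially (`Linearization.muAction_one`).

*The decomposition.* As `m` is invertible in `k` and `k` is algebraically closed, the projectors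
`|G|⁻¹ ∑ χ(g)⁻¹ g` are a complete system of orthogonal idempotents of `F_* E`. They split in the
abelian category of `𝒪`-modules, and their images are the isotypic components
(`exists_isotypic_decomposition`).

*The ranks.* Over the chart `xᵢ ≠ 0` the comorphism of `F` raises the variables of a polynomial ring
to their `m`-th powers, so it is finite and free of degree `mⁿ` (`free_toricFrobenius_app`). Hence
the sections of `F_* E` are projective of rank `mⁿ · rk E`, and so their direct summands, the
sections of the `mⁿ` components, are projective too. Every character of `G` is the weight of some
non-zero function upstairs, namely a monomial divided by a power of `xᵢ ^ m`
(`exists_eigenfunction`). Multiplication by such functions embeds every component into every other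
one, so all components have the same rank, which must be `rk E` (`finrank_summand_of_pushforward`).

*Back to sheaves.* To conclude that a component is a vector bundle from the projectivity of its
sections over the charts, it has to be quasi-coherent there. For this, quasi-coherence on an affine
open subset is expressed by extending and annihilating sections (`IsQCohAt`), a condition that is
inherited by pushforwards and direct summands without any further theory.
-/

namespace ToricFrobenius

/-! ### Pullbacks of modules along composite morphisms -/

open Scheme.Modules

section Coherence

variable {X Y Z T : Scheme.{u}}

lemma pullbackEq_rfl {a : X ⟶ Y} (M : Y.Modules) : pullbackEq (rfl : a = a) M = 𝟙 _ := rfl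

lemma pullbackEq_trans {a b c : X ⟶ Y} (h : a = b) (h' : b = c) (M : Y.Modules) :
    pullbackEq h M ≫ pullbackEq h' M = pullbackEq (h.trans h') M := by
  subst h h'
  simp [pullbackEq_rfl]

lemma pullbackHom_comp (h : Z ⟶ X) {a b c : X ⟶ Y} {M : Y.Modules}
    (φ : (pullback a).obj M ⟶ (pullback b).obj M) (ψ : (pullback b).obj M ⟶ (pullback c).obj M) :
    pullbackHom h (φ ≫ ψ) = pullbackHom h φ ≫ pullbackHom h ψ := by
  simp [pullbackHom]

lemma pullbackHom_id (h : Z ⟶ X) (a : X ⟶ Y) (M : Y.Modules) :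
    pullbackHom h (𝟙 ((pullback a).obj M)) = 𝟙 _ := by
  simp [pullbackHom]

lemma pullbackHom_pullbackEq (h : Z ⟶ X) {a b : X ⟶ Y} (e : a = b) (M : Y.Modules) :
    pullbackHom h (pullbackEq e M) = pullbackEq (by rw [e]) M := by
  subst e
  exact pullbackHom_id h a M

lemma pullbackHom_congr {h h' : Z ⟶ X} (e : h = h') {a b : X ⟶ Y} {M : Y.Modules}
    (φ : (pullback a).obj M ⟶ (pullback b).obj M) :
    pullbackHom h φ = pullbackEq (by rw [e]) M ≫ pullbackHom h' φ ≫ pullbackEq (by rw [e]) M := by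
  subst e
  simp [pullbackEq_rfl]

lemma pullbackComp_assoc (f : X ⟶ Y) (g : Y ⟶ Z) (h : Z ⟶ T) (M : T.Modules) :
    (pullbackComp f (g ≫ h)).inv.app M ≫ (pullback f).map ((pullbackComp g h).inv.app M) =
      pullbackEq (Category.assoc f g h).symm M ≫ (pullbackComp (f ≫ g) h).inv.app M ≫
        (pullbackComp f g).inv.app ((pullback h).obj M) := by
  have H := congr_app (pseudofunctor_associativity f g h) M
  have e : (eqToHom (by simp) : pullback (f ≫ g ≫ h) ⟶ pullback ((f ≫ g) ≫ h)).app M =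
    pullbackEq (Category.assoc f g h).symm M := rfl
  rw [e] at H
  rw [← H]
  simp

lemma pullbackComp_assoc' (f : X ⟶ Y) (g : Y ⟶ Z) (h : Z ⟶ T) (M : T.Modules) :
    (pullback f).map ((pullbackComp g h).hom.app M) ≫ (pullbackComp f (g ≫ h)).hom.app M =
      (pullbackComp f g).hom.app ((pullback h).obj M) ≫ (pullbackComp (f ≫ g) h).hom.app M ≫
        pullbackEq (Category.assoc f g h) M := by
  have H := pullbackComp_assoc f g h M
  rw [← cancel_epi ((pullbackComp f (g ≫ h)).inv.app M ≫
    (pullback f).map ((pullbackComp g h).inv.app M))]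
  conv_rhs => rw [H]
  simp only [Category.assoc, ← Functor.map_comp_assoc, Iso.inv_hom_id_app, Iso.inv_hom_id_app_assoc]
  simp [pullbackEq_trans, pullbackEq_rfl]

/-- Pulling back in two steps is pulling back along the composition, up to the canonical
identifications of the modules. -/
lemma pullbackHom_pullbackHom (h : T ⟶ Z) (h' : Z ⟶ X) {a b : X ⟶ Y} {M : Y.Modules}
    (φ : (pullback a).obj M ⟶ (pullback b).obj M) :
    pullbackHom h (pullbackHom h' φ) =
      pullbackEq (Category.assoc h h' a).symm M ≫ pullbackHom (h ≫ h') φ ≫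
        pullbackEq (Category.assoc h h' b) M := by
  have nat : (pullback h).map ((pullback h').map φ) ≫
      (pullbackComp h h').hom.app ((pullback b).obj M) =
      (pullbackComp h h').hom.app ((pullback a).obj M) ≫ (pullback (h ≫ h')).map φ :=
    (pullbackComp h h').hom.naturality φ
  simp only [pullbackHom, Functor.map_comp, Category.assoc]
  rw [reassoc_of% pullbackComp_assoc h h' a M, pullbackComp_assoc', reassoc_of% nat,
    Iso.inv_hom_id_app_assoc]

/-- The isomorphism `h^* M ⟶ M` for a morphism `h` that is the identity. -/
noncomputable def pullbackOne {h : X ⟶ X} (e : h = 𝟙 X) (M : X.Modules) :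
    (pullback h).obj M ⟶ M :=
  pullbackEq e M ≫ (pullbackId X).hom.app M

lemma pullbackComp_inv_map_pullbackOne (h : Z ⟶ X) {b : X ⟶ X} (e : b = 𝟙 X) (M : X.Modules) :
    (pullbackComp h b).inv.app M ≫ (pullback h).map (pullbackOne e M) =
      pullbackEq (by rw [e, Category.comp_id]) M := by
  subst e
  have H := congr_app (pseudofunctor_left_unitality h) M
  simp only [NatTrans.comp_app, Functor.whiskerRight_app, Functor.leftUnitor_hom_app] at H
  simp only [pullbackOne, pullbackEq_rfl, Category.id_comp]
  exact (congrArg (_ ≫ ·) (Category.comp_id _).symm).trans H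

/-- The morphism `N ⟶ f_* M` which corresponds to `α : f^* N ⟶ M`. -/
noncomputable def transpose {f : X ⟶ Y} {M : X.Modules} {N : Y.Modules}
    (α : (pullback f).obj N ⟶ M) : N ⟶ (pushforward f).obj M :=
  (pullbackPushforwardAdjunction f).unit.app N ≫ (pushforward f).map α

/-- The transpose of `(g ∘ f)^* N ≅ f^* g^* N ⟶ f^* M ⟶ K` is the composition of
`N ⟶ g_* M ⟶ g_* f_* K` with `g_* f_* K ≅ (g ∘ f)_* K`. -/
lemma transpose_comp (f : X ⟶ Y) (g : Y ⟶ Z) {K : X.Modules} {M : Y.Modules} {N : Z.Modules}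
    (α : (pullback f).obj M ⟶ K) (β : (pullback g).obj N ⟶ M) :
    transpose ((pullbackComp f g).inv.app N ≫ (pullback f).map β ≫ α) =
    transpose β ≫ (pushforward g).map (transpose α) ≫ (pushforwardComp f g).hom.app K := by
  have H := unit_conjugateEquiv
    ((pullbackPushforwardAdjunction g).comp (pullbackPushforwardAdjunction f))
    (pullbackPushforwardAdjunction (f ≫ g)) (pullbackComp f g).inv N
  rw [conjugateEquiv_pullbackComp_inv] at H
  simp only [transpose]
  rw [Functor.map_comp, ← reassoc_of% H]
  have n1 := (pushforwardComp f g).hom.naturality ((pullback f).map β ≫ α)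
  have n2 := (pullbackPushforwardAdjunction f).unit.naturality β
  simp only [Functor.comp_obj, Functor.comp_map, Functor.id_obj, Functor.id_map] at n1 n2
  erw [← n1]
  simp only [Adjunction.comp_unit_app, Functor.map_comp, Category.assoc]
  rw [← Functor.map_comp_assoc _ _ ((pullbackPushforwardAdjunction f).unit.app M), n2,
    Functor.map_comp, Category.assoc]

lemma pullbackComp_inv_map_comp (h : Z ⟶ X) {a b : X ⟶ Y} {M : Y.Modules} {K : X.Modules}
    (φ : (pullback a).obj M ⟶ (pullback b).obj M) (ψ : (pullback b).obj M ⟶ K) :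
    (pullbackComp h a).inv.app M ≫ (pullback h).map (φ ≫ ψ) =
      pullbackHom h φ ≫ (pullbackComp h b).inv.app M ≫ (pullback h).map ψ := by
  simp [pullbackHom]

lemma sandwich_trans {C : Type*} [Category* C] {X₀ X₁ X₂ Y₀ Y₁ Y₂ : C} {F : X₀ ⟶ Y₀} {G : X₁ ⟶ Y₁}
    {H : X₂ ⟶ Y₂} {a : X₀ ⟶ X₁} {b : Y₁ ⟶ Y₀} {c : X₁ ⟶ X₂} {d : Y₂ ⟶ Y₁} {a' : X₀ ⟶ X₂}
    {b' : Y₂ ⟶ Y₀} (hF : F = a ≫ G ≫ b) (hG : G = c ≫ H ≫ d) (ha : a ≫ c = a') (hb : d ≫ b = b') :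
    F = a' ≫ H ≫ b' := by
  subst hF hG ha hb
  simp only [Category.assoc]

lemma sandwich_symm {C : Type*} [Category* C] {X₁ X₂ Y₁ Y₂ : C} {G : X₁ ⟶ Y₁}
    {H : X₂ ⟶ Y₂} {c : X₁ ⟶ X₂} {d : Y₂ ⟶ Y₁} {c' : X₂ ⟶ X₁} {d' : Y₁ ⟶ Y₂}
    (hG : G = c ≫ H ≫ d) (hc : c' ≫ c = 𝟙 _) (hd : d ≫ d' = 𝟙 _) : H = c' ≫ G ≫ d' := by
  subst hG
  simp only [Category.assoc, hd, reassoc_of% hc, Category.comp_id]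

lemma pullbackHom_of_eq_comp {h : T ⟶ Z} {h' : Z ⟶ X} {g : T ⟶ X}
    (e : h ≫ h' = g) {a b : X ⟶ Y} {M : Y.Modules}
    (φ : (pullback a).obj M ⟶ (pullback b).obj M) :
    pullbackHom h (pullbackHom h' φ) =
      pullbackEq (by rw [← e, Category.assoc]) M ≫
        pullbackHom g φ ≫ pullbackEq (by rw [← e, Category.assoc]) M :=
  sandwich_trans (pullbackHom_pullbackHom h h' φ) (pullbackHom_congr e φ)
    (pullbackEq_trans _ _ _) (pullbackEq_trans _ _ _)

lemma pullbackHom_of_eq_comp' {h : T ⟶ Z} {h' : Z ⟶ X} {g : T ⟶ X}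
    (e : h ≫ h' = g) {a b : X ⟶ Y} {M : Y.Modules}
    (φ : (pullback a).obj M ⟶ (pullback b).obj M) :
    pullbackHom g φ =
      pullbackEq (by rw [← e, Category.assoc]) M ≫
        pullbackHom h (pullbackHom h' φ) ≫ pullbackEq (by rw [← e, Category.assoc]) M :=
  sandwich_symm (pullbackHom_of_eq_comp e φ) (pullbackEq_trans _ _ _) (pullbackEq_trans _ _ _)

lemma pullbackHom_of_comp_eq {W : Scheme.{u}} {h : T ⟶ Z} {h' : Z ⟶ X} {g : T ⟶ W} {g' : W ⟶ X}
    (e : h ≫ h' = g ≫ g') {a b : X ⟶ Y} {M : Y.Modules}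
    (φ : (pullback a).obj M ⟶ (pullback b).obj M) :
    pullbackHom h (pullbackHom h' φ) =
      pullbackEq (by rw [← Category.assoc, e, Category.assoc]) M ≫
        pullbackHom g (pullbackHom g' φ) ≫
        pullbackEq (by rw [← Category.assoc, ← e, Category.assoc]) M :=
  sandwich_trans (pullbackHom_of_eq_comp e φ) (pullbackHom_of_eq_comp' rfl φ)
    (pullbackEq_trans _ _ _) (pullbackEq_trans _ _ _)

/-- The diagram chase in `restrict_cocycle`, where all unnamed arrows are canonical isomorphisms. -/
lemma cocycle_chase {C : Type*} [Category* C] {X₀ X₁ X₂ X₃ X₄ X₅ X₆ X₇ X₈ X₉ : C}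
    {Y₁ Y₂ Y₃ Y₄ Z₁ Z₂ E : C}
    {F : X₁ ⟶ X₂} {K : X₃ ⟶ X₄} {n₁ : X₁ ⟶ X₃} {n₂ : X₄ ⟶ X₂} (hF : F = n₁ ≫ K ≫ n₂)
    {Kα : X₅ ⟶ X₆} {Kq : X₇ ⟶ X₈} {r₁ : X₃ ⟶ X₅} {r₂ : X₆ ⟶ X₇} {r₃ : X₈ ⟶ X₄}
    (hK : K = r₁ ≫ Kα ≫ r₂ ≫ Kq ≫ r₃)
    {P : Y₁ ⟶ Y₂} {a₁ : X₅ ⟶ Y₁} {a₂ : Y₂ ⟶ X₆} (hα : Kα = a₁ ≫ P ≫ a₂)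
    {G : Y₃ ⟶ Y₄} {g₁ : X₇ ⟶ Y₃} {g₂ : Y₄ ⟶ X₈} (hq : Kq = g₁ ≫ G ≫ g₂)
    {B : Z₁ ⟶ Z₂} {q₁ : Z₁ ⟶ Y₁} {q₂ : Y₂ ⟶ Z₂} (hB : B = q₁ ≫ P ≫ q₂)
    {u : X₀ ⟶ X₁} {v : X₂ ⟶ X₉} {ι : X₉ ⟶ E} {w : X₀ ⟶ Z₁} {x : Z₂ ⟶ Y₃} {y : Y₄ ⟶ X₉}
    (h₁ : u ≫ n₁ ≫ r₁ ≫ a₁ = w ≫ q₁) (h₂ : a₂ ≫ r₂ ≫ g₁ = q₂ ≫ x)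
    (h₃ : g₂ ≫ r₃ ≫ n₂ ≫ v = y) :
    u ≫ F ≫ v ≫ ι = w ≫ B ≫ x ≫ G ≫ y ≫ ι := by
  subst hF hK hα hq hB h₃
  simp only [Category.assoc]
  rw [reassoc_of% h₁, reassoc_of% h₂]

/-- The cocycle condition on `𝕋 × 𝕋 × X`, restricted to a pair of points `(s, t)` of `𝕋`:
the isomorphism attached to `s t` is `(s t)^* E ≅ t^* s^* E ⟶ t^* E ⟶ E`. -/
lemma restrict_cocycle {σ p : Y ⟶ X} {E : X.Modules}
    (φ : (pullback σ).obj E ⟶ (pullback p).obj E)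
    {μ α q : Z ⟶ Y} (h₁ : μ ≫ σ = α ≫ σ) (h₂ : α ≫ p = q ≫ σ) (h₃ : q ≫ p = μ ≫ p)
    (cocycle : pullbackHom μ φ = pullbackEq h₁ E ≫ pullbackHom α φ ≫ pullbackEq h₂ E ≫
      pullbackHom q φ ≫ pullbackEq h₃ E)
    {gs gt gst τs τt τst} (hs : τs = gs ≫ σ) (hs' : gs ≫ p = 𝟙 X)
    (ht : τt = gt ≫ σ) (ht' : gt ≫ p = 𝟙 X) (hst : τst = gst ≫ σ) (hst' : gst ≫ p = 𝟙 X)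
    (e : X ⟶ Z) (hμ : e ≫ μ = gst) (hq : e ≫ q = gt) (hα : e ≫ α = τt ≫ gs)
    (hτ : τst = τt ≫ τs) :
    (pullbackEq hst E ≫ pullbackHom gst φ ≫ pullbackEq hst' E ≫ (pullbackId X).hom.app E :
        (pullback τst).obj E ⟶ E) =
      pullbackEq hτ E ≫ (pullbackComp τt τs).inv.app E ≫
        (pullback τt).map (pullbackEq hs E ≫ pullbackHom gs φ ≫ pullbackEq hs' E ≫
          (pullbackId X).hom.app E : (pullback τs).obj E ⟶ E) ≫
        pullbackEq ht E ≫ pullbackHom gt φ ≫ pullbackEq ht' E ≫ (pullbackId X).hom.app E := by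
  have hK : pullbackHom e (pullbackHom μ φ) =
      pullbackHom e (pullbackEq h₁ E) ≫ pullbackHom e (pullbackHom α φ) ≫
        pullbackHom e (pullbackEq h₂ E) ≫ pullbackHom e (pullbackHom q φ) ≫
        pullbackHom e (pullbackEq h₃ E) := by
    rw [cocycle, pullbackHom_comp, pullbackHom_comp, pullbackHom_comp, pullbackHom_comp]
  rw [pullbackHom_pullbackEq, pullbackHom_pullbackEq, pullbackHom_pullbackEq] at hK
  have h1 {h : X ⟶ X} (e : h = 𝟙 X) :
      (pullbackEq e E ≫ (pullbackId X).hom.app E : (pullback h).obj E ⟶ E) =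
        pullbackOne e E := by
    rw [pullbackOne]
  have hB := pullbackComp_inv_map_comp τt (pullbackEq hs E)
    (pullbackHom gs φ ≫ pullbackEq hs' E ≫ (pullbackId X).hom.app E : _ ⟶ E)
  rw [pullbackComp_inv_map_comp τt (pullbackHom gs φ), h1,
    pullbackComp_inv_map_pullbackOne, pullbackHom_pullbackEq] at hB
  rw [← Category.assoc ((pullbackComp τt τs).inv.app E)]
  exact cocycle_chase (pullbackHom_of_eq_comp' hμ φ) hK (pullbackHom_of_comp_eq hα φ)
    (pullbackHom_of_eq_comp hq φ) hB (by simp only [pullbackEq_trans])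
    (by simp only [pullbackEq_trans])
    (by simp only [pullbackEq_trans])

end Coherence

/-! ### The action of `μₘⁿ` -/

section Action

variable {n : ℕ} {k : Type u} [Field k]

/-- Evaluation of regular functions on `𝕋 × 𝕋` at the `k`-point `(s, t)`. -/
noncomputable def torusEval₂ (s t : Fin n → kˣ) : TorusRing₂ n k →+* k :=
  (Algebra.TensorProduct.lift
    ({ torusEval s with commutes' := fun r ↦ by simp [torusEval] } : TorusRing n k →ₐ[k] k)
    ({ torusEval t with commutes' := fun r ↦ by simp [torusEval] } : TorusRing n k →ₐ[k] k)
    fun _ _ ↦ mul_comm _ _).toRingHom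

lemma torusEval₂_inl (s t : Fin n → kˣ) (r : TorusRing n k) :
    torusEval₂ s t (torusInl n k r) = torusEval s r := by
  exact (Algebra.TensorProduct.lift_tmul _ _ _ r 1).trans (by simp)

lemma torusEval₂_inr (s t : Fin n → kˣ) (r : TorusRing n k) :
    torusEval₂ s t (torusInr n k r) = torusEval t r := by
  exact (Algebra.TensorProduct.lift_tmul _ _ _ 1 r).trans (by simp)

lemma torusEval₂_comul (s t : Fin n → kˣ) (r : TorusRing n k) :
    torusEval₂ s t (torusComul n k r) = torusEval (s * t) r := by
  refine DFunLike.congr_fun (f := (torusEval₂ s t).comp (torusComul n k)) (g := torusEval (s * t))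
    ?_ r
  refine AddMonoidAlgebra.ringHom_ext (fun a ↦ ?_) (fun a ↦ ?_)
  · simp [torusEval₂, torusComul, torusEval]
  · simp [torusEval₂, torusComul, torusEval, mul_zpow, Finset.prod_mul_distrib]

/-- The morphism `ℙⁿ ⟶ 𝕋 × 𝕋 × ℙⁿ`, `x ↦ (s, t, x)`, for `k`-points `s` and `t` of `𝕋`. -/
noncomputable def slice₂ (s t : Fin n → kˣ) : ProjSpace n k ⟶ ProjSpace n (TorusRing₂ n k) :=
  coordMap (torusEval₂ s t) 1 1 one_pos

lemma slice₂_mulMap (s t : Fin n → kˣ) : slice₂ s t ≫ mulMap n k = slice (s * t) :=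
  coordMap_comp _ _ _ one_pos _ _ _ one_pos _ _ 1 one_pos
    (fun r ↦ (torusEval₂_comul s t r).symm) (fun i ↦ by simp) rfl

lemma slice₂_proj₂₃ (s t : Fin n → kˣ) : slice₂ s t ≫ proj₂₃ n k = slice t :=
  coordMap_comp _ _ _ one_pos _ _ _ one_pos _ _ 1 one_pos
    (fun r ↦ (torusEval₂_inr s t r).symm) (fun i ↦ by simp) rfl

lemma slice₂_actMap (s t : Fin n → kˣ) : slice₂ s t ≫ actMap n k = translate t ≫ slice s := by
  rw [slice₂, actMap, translate, slice,
    coordMap_comp _ _ _ one_pos _ _ _ one_pos (torusEval s) t 1 one_pos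
      (fun r ↦ (torusEval₂_inl s t r).symm)
      (fun i ↦ by simp [torusEval₂_inr, torusEval_coord]) rfl,
    coordMap_comp _ _ _ one_pos _ _ _ one_pos (torusEval s) t 1 one_pos
      (fun r ↦ rfl) (fun i ↦ by simp) rfl]

lemma translate_comp (s t : Fin n → kˣ) : translate t ≫ translate s = translate (k := k) (s * t) :=
  coordMap_comp _ _ _ one_pos _ _ _ one_pos _ _ 1 one_pos (fun r ↦ rfl) (fun i ↦ by simp) rfl

lemma translate_one : translate (1 : Fin n → kˣ) = 𝟙 (ProjSpace n k) :=
  coordMap_id _ _ (fun _ ↦ rfl) (fun _ ↦ rfl)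

variable {E : (ProjSpace n k).Modules} (L : Linearization E)

/-- The isomorphisms `g^* E ≅ E` given by a linearization are compatible with products of points. -/
lemma Linearization.atPoint_mul {p s t : Fin n → kˣ} (hp : p = s * t)
    (e : translate p = translate t ≫ translate s) : L.atPoint p =
    pullbackEq e E ≫ (pullbackComp (translate t) (translate s)).inv.app E ≫
      (pullback (translate t)).map (L.atPoint s) ≫ L.atPoint t := by
  rw [Linearization.atPoint, Linearization.atPoint, Linearization.atPoint]
  exact restrict_cocycle L.iso.hom (mulMap_act n k) (actMap_proj₂ n k) (proj₂₃_proj₂ n k)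
    L.cocycle _ _ _ _ _ _ (slice₂ s t) (by rw [slice₂_mulMap, hp]) (slice₂_proj₂₃ s t)
    (slice₂_actMap s t) _

instance isIso_pullbackEq {X Y : Scheme.{u}} {a b : X ⟶ Y} (h : a = b) (M : Y.Modules) :
    IsIso (pullbackEq h M) := by
  subst h
  rw [pullbackEq_rfl]
  infer_instance

instance isIso_pullbackHom {X Y Z : Scheme.{u}} (h : Z ⟶ X) {a b : X ⟶ Y} {M : Y.Modules}
    (φ : (pullback a).obj M ⟶ (pullback b).obj M) [IsIso φ] : IsIso (pullbackHom h φ) := by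
  rw [pullbackHom]
  infer_instance

instance Linearization.isIso_atPoint (g : Fin n → kˣ) : IsIso (L.atPoint g) := by
  rw [Linearization.atPoint]
  infer_instance

/-- The endomorphism of `F_* E` attached to `a : E ⟶ τ_* E` for `F ∘ τ = F`. -/
noncomputable def pushforwardEnd {P Q : Scheme.{u}} {τ : P ⟶ P} {F : P ⟶ Q} (h : τ ≫ F = F)
    {E : P.Modules} (a : E ⟶ (pushforward τ).obj E) :
    (pushforward F).obj E ⟶ (pushforward F).obj E :=
  (pushforward F).map a ≫ (pushforwardComp τ F).hom.app E ≫ (pushforwardCongr h).hom.app E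

lemma Linearization.muAction_eq {m : ℕ} (hm : 0 < m) (g : MuPow n k m) :
    L.muAction hm g =
      pushforwardEnd (translate_toricFrobenius hm g) (transpose (L.atPoint g.toPoint)) := by
  rw [Linearization.muAction, pushforwardEnd, transpose]

/-- On sections, `pushforwardEnd h a` is `a`, up to the identification `τ⁻¹ F⁻¹ U = F⁻¹ U`. -/
lemma pushforwardEnd_app {P Q : Scheme.{u}} {τ : P ⟶ P} {F : P ⟶ Q} (h : τ ≫ F = F)
    {E : P.Modules} (a : E ⟶ (pushforward τ).obj E) (U : Q.Opens) (s : Γ(E, F ⁻¹ᵁ U)) :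
    (pushforwardEnd h a).app U s =
      E.presheaf.map (homOfLE (show F ⁻¹ᵁ U ≤ τ ⁻¹ᵁ F ⁻¹ᵁ U by
        rw [← Scheme.Hom.comp_preimage, h])).op (show Γ(E, τ ⁻¹ᵁ F ⁻¹ᵁ U) from
        a.app (F ⁻¹ᵁ U) s) := rfl

/-- Composition of the endomorphisms attached to `E ⟶ σ_* E` and `E ⟶ τ_* E` corresponds to the
composition `E ⟶ σ_* E ⟶ σ_* τ_* E`. -/
lemma pushforwardEnd_comp {P Q : Scheme.{u}} {σ τ : P ⟶ P} {F : P ⟶ Q} (hσ : σ ≫ F = F)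
    (hτ : τ ≫ F = F) (hρ : (τ ≫ σ) ≫ F = F) {E : P.Modules}
    (a : E ⟶ (pushforward σ).obj E) (b : E ⟶ (pushforward τ).obj E) :
    pushforwardEnd hρ (a ≫ (pushforward σ).map b ≫ (pushforwardComp τ σ).hom.app E) =
      pushforwardEnd hσ a ≫ pushforwardEnd hτ b := by
  have nat {V W : P.Opens} (i : V ⟶ W) (s : Γ(E, W)) : b.app V (E.presheaf.map i.op s) =
      E.presheaf.map ((TopologicalSpace.Opens.map τ.base).map i).op
        (show Γ(E, τ ⁻¹ᵁ W) from b.app W s) :=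
    ConcreteCategory.congr_hom (b.mapPresheaf.naturality i.op) s
  refine Scheme.Modules.hom_ext _ _ fun U ↦ ConcreteCategory.hom_ext _ _ fun s ↦ ?_
  rw [Hom.comp_app, ConcreteCategory.comp_apply]
  refine (pushforwardEnd_app hρ _ U s).trans (Eq.trans ?_ (pushforwardEnd_app hτ b U _).symm)
  refine Eq.trans ?_ (congrArg (fun z : Γ(E, F ⁻¹ᵁ U) ↦ E.presheaf.map (homOfLE _).op
    (show Γ(E, τ ⁻¹ᵁ F ⁻¹ᵁ U) from b.app (F ⁻¹ᵁ U) z)) (pushforwardEnd_app hσ a U s)).symm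
  have hle : F ⁻¹ᵁ U ≤ τ ⁻¹ᵁ F ⁻¹ᵁ U := by rw [← Scheme.Hom.comp_preimage, hτ]
  refine Eq.trans ?_ (congrArg (E.presheaf.map (homOfLE hle).op)
    (nat (homOfLE (show F ⁻¹ᵁ U ≤ σ ⁻¹ᵁ F ⁻¹ᵁ U by rw [← Scheme.Hom.comp_preimage, hσ]))
      (a.app (F ⁻¹ᵁ U) s))).symm
  change _ = (E.presheaf.map _ ≫ E.presheaf.map _) _
  rw [← Functor.map_comp]
  rfl

lemma pushforwardEnd_transpose_pullbackEq {P Q : Scheme.{u}} {ρ ρ' : P ⟶ P} {F : P ⟶ Q}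
    (hρ : ρ ≫ F = F) (e : ρ = ρ') (hρ' : ρ' ≫ F = F) {E : P.Modules}
    (γ : (pullback ρ').obj E ⟶ E) :
    pushforwardEnd hρ (transpose (pullbackEq e E ≫ γ)) = pushforwardEnd hρ' (transpose γ) := by
  subst e
  rw [pullbackEq_rfl, Category.id_comp]

lemma pushforwardEnd_transpose_comp {P Q : Scheme.{u}} {σ τ ρ : P ⟶ P} {F : P ⟶ Q}
    (hσ : σ ≫ F = F) (hτ : τ ≫ F = F) (hρ : ρ ≫ F = F) (e : ρ = τ ≫ σ) {E : P.Modules}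
    (α : (pullback σ).obj E ⟶ E) (β : (pullback τ).obj E ⟶ E) :
    pushforwardEnd hρ (transpose (pullbackEq e E ≫ (pullbackComp τ σ).inv.app E ≫
      (pullback τ).map α ≫ β)) =
      pushforwardEnd hσ (transpose α) ≫ pushforwardEnd hτ (transpose β) := by
  rw [pushforwardEnd_transpose_pullbackEq hρ e (by rw [← e, hρ]), transpose_comp,
    pushforwardEnd_comp]

lemma Linearization.muAction_mul {m : ℕ} (hm : 0 < m) (g h : MuPow n k m) :
    L.muAction hm (g * h) = L.muAction hm g ≫ L.muAction hm h := by
  have e : translate (g * h).toPoint = translate h.toPoint ≫ translate (k := k) g.toPoint :=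
    (translate_comp g.toPoint h.toPoint).symm
  rw [L.muAction_eq, L.muAction_eq, L.muAction_eq,
    L.atPoint_mul (p := (g * h).toPoint) (s := g.toPoint) (t := h.toPoint) rfl e,
    pushforwardEnd_transpose_comp]

instance {P : Scheme.{u}} : (pushforward (𝟙 P)).IsEquivalence :=
  Functor.isEquivalence_of_iso (pushforwardId P).symm

/-- Along the identity, pullback and pushforward are equivalences, so transposing preserves
isomorphisms. -/
lemma isIso_transpose {P : Scheme.{u}} {τ : P ⟶ P} (h : τ = 𝟙 P) {E : P.Modules}
    (α : (pullback τ).obj E ⟶ E) [IsIso α] : IsIso (transpose α) := by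
  subst h
  rw [transpose]
  have : IsIso ((pullbackPushforwardAdjunction (𝟙 P)).unit.app E) :=
    (pullbackPushforwardAdjunction (𝟙 P)).isIso_unit_app_of_iso
      ((pushforward (𝟙 P)).objObjPreimageIso E).symm
  infer_instance

/-- The action of `1` is an isomorphism, and idempotent by multiplicativity, hence the identity. -/
lemma Linearization.muAction_one {m : ℕ} (hm : 0 < m) :
    L.muAction hm (1 : MuPow n k m) = 𝟙 _ := by
  have : IsIso (L.muAction hm (1 : MuPow n k m)) := by
    have e : translate (MuPow.toPoint (1 : MuPow n k m)) = 𝟙 (ProjSpace n k) := translate_one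
    have := L.isIso_atPoint (MuPow.toPoint (1 : MuPow n k m))
    have := isIso_transpose e (L.atPoint (MuPow.toPoint (1 : MuPow n k m)))
    rw [L.muAction_eq, pushforwardEnd]
    infer_instance
  have h := L.muAction_mul hm (1 : MuPow n k m) 1
  rw [mul_one] at h
  rw [← cancel_epi (L.muAction hm (1 : MuPow n k m)), ← h, Category.comp_id]

end Action

end ToricFrobenius

namespace ToricFrobenius
/-! ### Quasi-coherence on an affine open subset -/

open Scheme.Modules

section QuasiCoherence

variable {X : Scheme.{u}}

/-- Every section of `M` over `D(f) ⊆ U` extends to `U` after multiplication by a power of `f`, and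
a section over `U` which vanishes on `D(f)` is killed by a power of `f`. For affine `U` this says
that `M` is quasi-coherent on `U` (`isQCohAt_iff`), but it visibly passes to pushforwards, for which
`U` is replaced by its preimage, and to retracts. The open set `V = D(f)` is a variable to allow for
sets that equal `D(f)` only propositionally. -/
def IsQCohAt (M : X.Modules) (U : X.Opens) : Prop :=
  ∀ (f : Γ(X, U)) (V : X.Opens) (_ : V = X.basicOpen f) (hVU : V ≤ U),
    (∀ s : Γ(M, V), ∃ (n : ℕ) (t : Γ(M, U)),
      M.presheaf.map (homOfLE hVU).op t = X.presheaf.map (homOfLE hVU).op f ^ n • s) ∧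
    ∀ t : Γ(M, U), M.presheaf.map (homOfLE hVU).op t = 0 → ∃ n : ℕ, f ^ n • t = 0

lemma pushforward_smul {Y : Scheme.{u}} (F : X ⟶ Y) (M : X.Modules) {U : Y.Opens} (r : Γ(Y, U))
    (s : Γ((pushforward F).obj M, U)) :
    r • s = (show Γ((pushforward F).obj M, U) from F.app U r • (show Γ(M, F ⁻¹ᵁ U) from s)) := rfl

lemma IsQCohAt.pushforward {Y : Scheme.{u}} (F : X ⟶ Y) {M : X.Modules} {U : Y.Opens}
    (h : IsQCohAt M (F ⁻¹ᵁ U)) : IsQCohAt ((pushforward F).obj M) U := by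
  intro f V hV hVU
  obtain ⟨h₁, h₂⟩ := h (F.app U f) (F ⁻¹ᵁ V) (by rw [hV, Scheme.preimage_basicOpen])
    (F.preimage_mono hVU)
  constructor
  · intro s
    obtain ⟨n, t, ht⟩ := h₁ s
    refine ⟨n, t, ht.trans ?_⟩
    rw [pushforward_smul, map_pow]
    congr 2
    exact (ConcreteCategory.congr_hom (F.naturality (homOfLE hVU).op) f).symm
  · intro t ht
    obtain ⟨n, hn⟩ := h₂ t ht
    refine ⟨n, ?_⟩
    rw [pushforward_smul, map_pow]
    exact hn

lemma Hom.app_map {M N : X.Modules} (φ : M ⟶ N) {U V : X.Opens} (i : U ⟶ V) (s : Γ(M, V)) :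
    φ.app U (M.presheaf.map i.op s) = N.presheaf.map i.op (φ.app V s) :=
  ConcreteCategory.congr_hom (φ.mapPresheaf.naturality i.op) s

lemma IsQCohAt.of_retract {M N : X.Modules} {U : X.Opens} (h : IsQCohAt M U) (ι : N ⟶ M)
    (π : M ⟶ N) (hιπ : ι ≫ π = 𝟙 N) : IsQCohAt N U := by
  have key (W : X.Opens) (s : Γ(N, W)) : π.app W (ι.app W s) = s :=
    ConcreteCategory.congr_hom (congr($(hιπ).app W)) s
  intro f V hV hVU
  obtain ⟨h₁, h₂⟩ := h f V hV hVU
  constructor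
  · intro s
    obtain ⟨n, t, ht⟩ := h₁ (ι.app V s)
    refine ⟨n, π.app U t, ?_⟩
    rw [← Hom.app_map, ht, Hom.app_smul, key]
  · intro t ht
    obtain ⟨n, hn⟩ := h₂ (ι.app U t) (by rw [← Hom.app_map, ht, map_zero])
    refine ⟨n, ?_⟩
    rw [← key U t, ← Hom.app_smul, hn, map_zero]

end QuasiCoherence

section AffineSections

variable {X : Scheme.{u}} {U : X.Opens} (hU : IsAffineOpen U)

/-- A function on `U`, regarded as a function on `W ⊆ Spec Γ(X, U)` and transported to the image `V`
of `W` in `X`, becomes its restriction to `V`. -/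
lemma fromSpec_appIso_inv (W : (Spec Γ(X, U)).Opens) {V : X.Opens} (h : hU.fromSpec ''ᵁ W = V)
    (hV : V ≤ U) (r : Γ(X, U)) :
    X.presheaf.map (eqToHom h.symm).op ((hU.fromSpec.appIso W).inv
      ((Spec Γ(X, U)).presheaf.map W.leTop.op ((Scheme.ΓSpecIso Γ(X, U)).inv r))) =
      X.presheaf.map (homOfLE hV).op r := by
  subst h
  have : (Scheme.ΓSpecIso Γ(X, U)).inv ≫ (Spec Γ(X, U)).presheaf.map W.leTop.op =
    X.presheaf.map (homOfLE hV).op ≫ (hU.fromSpec.appIso W).hom := by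
    rw [Scheme.Hom.appIso_hom, Scheme.Hom.naturality_assoc, hU.fromSpec_app_self, Category.assoc,
      ← Functor.map_comp, ← Functor.map_comp]
    rfl
  have h2 := ConcreteCategory.congr_hom this r
  rw [ConcreteCategory.comp_apply, ConcreteCategory.comp_apply] at h2
  rw [h2, ← ConcreteCategory.comp_apply (hU.fromSpec.appIso W).hom, Iso.hom_inv_id]
  simp

/-- The sections over `W ⊆ Spec Γ(X, U)` of the restriction of `M` to `Spec Γ(X, U) ≅ U` are the
sections of `M` over the image `V` of `W`. -/
noncomputable def restrictSectionsEquiv (M : X.Modules) (W : (Spec Γ(X, U)).Opens) {V : X.Opens}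
    (h : hU.fromSpec ''ᵁ W = V) : Γ(M.restrict hU.fromSpec, W) ≃+ Γ(M, V) :=
  (M.restrictAppIso hU.fromSpec W ≪≫
    M.presheaf.mapIso (eqToIso h.symm).op).addCommGroupIsoToAddEquiv

lemma restrictSectionsEquiv_smul (M : X.Modules) (W : (Spec Γ(X, U)).Opens) {V : X.Opens}
    (h : hU.fromSpec ''ᵁ W = V) (hV : V ≤ U) (r : Γ(X, U)) (x : Γ(M.restrict hU.fromSpec, W)) :
    restrictSectionsEquiv hU M W h (r • x) =
      X.presheaf.map (homOfLE hV).op r • restrictSectionsEquiv hU M W h x := by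
  rw [← fromSpec_appIso_inv hU W h]
  exact (congrArg _ (smul_restrictAppIso_hom_apply hU.fromSpec M W _ x)).trans
    (M.map_smul (eqToHom h.symm) _ _)

lemma restrictSectionsEquiv_map (M : X.Modules) {W W' : (Spec Γ(X, U)).Opens} {V V' : X.Opens}
    (h : hU.fromSpec ''ᵁ W = V) (h' : hU.fromSpec ''ᵁ W' = V') (i : W ⟶ W') (j : V ⟶ V')
    (x : Γ(M.restrict hU.fromSpec, W')) :
    restrictSectionsEquiv hU M W h ((M.restrict hU.fromSpec).presheaf.map i.op x) =
      M.presheaf.map j.op (restrictSectionsEquiv hU M W' h' x) := by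
  change (M.presheaf.map _ ≫ M.presheaf.map _) _ = (M.presheaf.map _ ≫ M.presheaf.map _) _
  rw [← Functor.map_comp, ← Functor.map_comp]
  rfl

end AffineSections

end ToricFrobenius

namespace ToricFrobenius
open Scheme.Modules

section Quasicoherent

variable {X : Scheme.{u}} {U : X.Opens}

lemma isQCohAt_iff (hU : IsAffineOpen U) (M : X.Modules) :
    IsQCohAt M U ↔ (M.restrict hU.fromSpec).IsQuasicoherent := by
  rw [isQuasicoherent_iff_isIso_fromTildeΓ, isIso_fromTildeΓ_iff_isLocalizing]
  let e := restrictSectionsEquiv hU M ⊤ (V := U) (by simp)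
  have he (r : Γ(X, U)) (x) : e (r • x) = r • e x :=
    (restrictSectionsEquiv_smul hU M _ _ le_rfl r x).trans (congrArg (· • e x) (by simp))
  have hle (f : Γ(X, U)) := X.basicOpen_le f
  let D (f : Γ(X, U)) : (Spec Γ(X, U)).Opens := PrimeSpectrum.basicOpen f
  let e' (f : Γ(X, U)) := restrictSectionsEquiv hU M (D f) (hU.fromSpec_image_basicOpen f)
  have he' (f : Γ(X, U)) (r : Γ(X, U)) (x : Γ(M.restrict hU.fromSpec, D f)) :
      e' f (r • x) = X.presheaf.map (homOfLE (hle f)).op r • e' f x :=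
    restrictSectionsEquiv_smul hU M _ _ (hle f) r x
  have hm (f : Γ(X, U)) (x) : e' f ((M.restrict hU.fromSpec).presheaf.map (D f).leTop.op x) =
    M.presheaf.map (homOfLE (hle f)).op (e x) := restrictSectionsEquiv_map hU M _ _ _ _ x
  constructor
  · intro h f
    refine IsLocalizedModule.Away.mk_of_addCommGroup ?_ ?_ ?_
    · exact Scheme.Modules.isUnit_algebraMap_end_of_le_basicOpen f le_rfl
    · intro x
      obtain ⟨n, t, ht⟩ := (h f _ rfl (hle f)).1 (e' f x)
      refine ⟨n, e.symm t, (e' f).injective ?_⟩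
      refine (he' f _ _).trans (Eq.trans ?_ (hm f (e.symm t)).symm)
      rw [e.apply_symm_apply, map_pow, ht]
    · intro x hx
      obtain ⟨n, hn⟩ := (h f _ rfl (hle f)).2 (e x)
        ((hm f x).symm.trans ((congrArg (e' f) hx).trans (map_zero _)))
      exact ⟨n, e.injective ((he _ _).trans (hn.trans (map_zero e).symm))⟩
  · intro h f V hV hVU
    subst hV
    have hf : IsLocalizedModule.Away f _ := h f
    constructor
    · intro s
      obtain ⟨n, y, hy⟩ := hf.surj _ _ ((e' f).symm s)
      refine ⟨n, e y, (hm f y).symm.trans ((congrArg (e' f) hy.symm).trans ((he' f _ _).trans ?_))⟩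
      rw [map_pow, AddEquiv.apply_symm_apply]
    · intro t ht
      obtain ⟨⟨_, n, rfl⟩, hn⟩ := (IsLocalizedModule.eq_zero_iff (.powers f) _).mp
        (show ((modulesSpecToSheaf.obj (M.restrict hU.fromSpec)).obj.map (D f).leTop.op).hom
            (e.symm t) = 0 from (e' f).injective <| (hm f _).trans <| by
          rw [e.apply_symm_apply, ht]; exact (map_zero (e' f)).symm)
      exact ⟨n, by rw [← e.apply_symm_apply t, ← he]; exact (congrArg e hn).trans (map_zero e)⟩

lemma IsQCohAt.of_le (hU : IsAffineOpen U) {V : X.Opens} (hV : IsAffineOpen V) (h : V ≤ U)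
    {M : X.Modules} (hM : IsQCohAt M U) : IsQCohAt M V := by
  rw [isQCohAt_iff hU] at hM
  rw [isQCohAt_iff hV]
  let j := Spec.map (X.presheaf.map (homOfLE h).op)
  have e : j ≫ hU.fromSpec = hV.fromSpec := hU.map_fromSpec hV _
  have : IsOpenImmersion j := by
    have : IsOpenImmersion (j ≫ hU.fromSpec) := by rw [e]; infer_instance
    exact IsOpenImmersion.of_comp j hU.fromSpec
  exact (SheafOfModules.isQuasicoherent (Spec Γ(X, V)).ringCatSheaf).prop_of_iso
    ((restrictFunctorComp j hU.fromSpec).symm.app M ≪≫ (restrictFunctorCongr e).app M)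
    (Scheme.Modules.isQuasicoherent_restrictFunctor j _)

end Quasicoherent

section FreePresentation

open SheafOfModules Limits

variable {C : Type*} [Category* C] {J : GrothendieckTopology C} {R : Sheaf J RingCat.{u}}
  [HasSheafify J AddCommGrpCat.{u}] [J.WEqualsLocallyBijective AddCommGrpCat.{u}]

/-- The presentation of a free module without relations. -/
noncomputable def freePresentation (I : Type u) : (free (R := R) I).Presentation where
  generators := free.generatingSections I
  relations :=
    { I := ULift Empty
      s := fun j ↦ j.down.elim
      epi := by
        have : IsIso (free.generatingSections (R := R) I).π := by
          rw [free.generatingSections_π]; exact IsIso.id _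
        exact IsZero.epi (IsZero.of_iso (isZero_zero _) (kernel.ofMono _)) _ }

end FreePresentation

/-- Transported to the category of modules over the slice site of `U x`, the local trivializations
are presentations without relations. -/
lemma isQuasicoherent_of_isVectorBundle {X : Scheme.{u}} {M : X.Modules} (hM : IsVectorBundle M) :
    M.IsQuasicoherent := by
  choose U r hx e using hM
  refine SheafOfModules.QuasicoherentData.isQuasicoherent (M := M) (R := X.ringCatSheaf)
    { I := X, X := U, coversTop := ?_, presentation := fun x ↦ ?_ }
  · rw [Opens.coversTop_iff, TopologicalSpace.IsOpenCover, eq_top_iff]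
    exact fun x _ ↦ TopologicalSpace.Opens.mem_iSup.mpr ⟨x, hx x⟩
  · have i : (overEquiv (U x)).inverse.obj (freeModule _ (r x)) ≅ M.over (U x) :=
      (overEquiv (U x)).inverse.mapIso ((e x).some.symm ≪≫ (overFunctorEquiv (U x)).symm.app M) ≪≫
        (overEquiv (U x)).unitIso.symm.app _
    let F : SheafOfModules.{u} (U x).toScheme.ringCatSheaf ⥤
      SheafOfModules.{u} (X.ringCatSheaf.over (U x)) := (overEquiv (U x)).inverse
    have : Limits.PreservesColimitsOfSize.{u, u} F :=
      inferInstanceAs (Limits.PreservesColimitsOfSize.{u, u} (overEquiv (U x)).inverse)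
    exact SheafOfModules.Presentation.ofIsIso i.hom
      ((freePresentation _).map F ((overEquiv (U x)).unitIso.app (SheafOfModules.unit _)))

end ToricFrobenius

namespace ToricFrobenius
/-! ### Local triviality on affine open subsets -/

open Scheme.Modules

section Free

/-- The restriction of `𝒪 ^ r` along an open immersion is `𝒪 ^ r`. -/
noncomputable def freeModuleRestrictIso {X Y : Scheme.{u}} (j : X ⟶ Y) [IsOpenImmersion j] (r : ℕ) :
    (freeModule Y r).restrict j ≅ freeModule X r :=
  let F : SheafOfModules.{u} Y.ringCatSheaf ⥤ SheafOfModules.{u} X.ringCatSheaf := restrictFunctor j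
  have : Limits.PreservesColimitsOfSize.{u, u} F :=
      inferInstanceAs (Limits.PreservesColimitsOfSize.{u, u} (restrictFunctor j))
  (SheafOfModules.mapFreeIso F (ULift.{u} (Fin r)) (restrictUnitIso j).symm).symm

lemma nonempty_iso_freeModule_iff {R : CommRingCat.{u}} (N : (Spec R).Modules) (r : ℕ) :
    Nonempty (N ≅ freeModule (Spec R) r) ↔
      N.IsQuasicoherent ∧ Nonempty (Γ(N, ⊤) ≃ₗ[R] (Fin r → R)) := by
  let e₀ : (ULift.{u} (Fin r) →₀ R) ≃ₗ[R] (Fin r → R) :=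
    Finsupp.domLCongr Equiv.ulift ≪≫ₗ Finsupp.linearEquivFunOnFinite R R (Fin r)
  let e₁ : tilde (ModuleCat.of R (ULift.{u} (Fin r) →₀ R)) ≅ freeModule (Spec R) r :=
    tildeFinsupp _
  constructor
  · rintro ⟨e⟩
    let e₂ : tilde (ModuleCat.of R (ULift.{u} (Fin r) →₀ R)) ≅ N := e₁ ≪≫ e.symm
    refine ⟨(SheafOfModules.isQuasicoherent (Spec R).ringCatSheaf).prop_of_iso e₂
      (inferInstanceAs (tilde (ModuleCat.of R (ULift.{u} (Fin r) →₀ R))).IsQuasicoherent), ⟨?_⟩⟩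
    exact (tilde.isoTop _ ≪≫ moduleSpecΓFunctor.mapIso e₂).toLinearEquiv.symm ≪≫ₗ e₀
  · rintro ⟨h, ⟨e⟩⟩
    rw [isQuasicoherent_iff_isIso_fromTildeΓ] at h
    let e' : (modulesSpecToSheaf.obj N).presheaf.obj (.op ⊤) ≃ₗ[R] (Fin r → R) := e
    exact ⟨(asIso N.fromTildeΓ).symm ≪≫
      (tilde.functor R).mapIso (e' ≪≫ₗ e₀.symm).toModuleIso ≪≫ e₁⟩

variable {X : Scheme.{u}}

lemma nonempty_restrict_iso_freeModule_of_comp {T S : Scheme.{u}} {M : X.Modules} {r : ℕ}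
    (j : T ⟶ X) [IsOpenImmersion j] (j' : S ⟶ X) [IsOpenImmersion j'] (f : T ⟶ S)
    [IsOpenImmersion f] (h : f ≫ j' = j) (e : Nonempty (M.restrict j' ≅ freeModule S r)) :
    Nonempty (M.restrict j ≅ freeModule T r) :=
  ⟨(restrictFunctorCongr h).symm.app M ≪≫ (restrictFunctorComp f j').app M ≪≫
    (restrictFunctor f).mapIso e.some ≪≫ freeModuleRestrictIso f r⟩

lemma nonempty_restrict_iso_freeModule_of_le {M : X.Modules} {r : ℕ} {U V : X.Opens} (h : V ≤ U)
    (e : Nonempty (M.restrict U.ι ≅ freeModule U r)) :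
    Nonempty (M.restrict V.ι ≅ freeModule V r) :=
  nonempty_restrict_iso_freeModule_of_comp V.ι U.ι (X.homOfLE h) (by simp) e

/-- On an affine open subset, triviality of a module can be read off from its sections. -/
lemma nonempty_restrict_iso_freeModule_iff {M : X.Modules} {r : ℕ} {V : X.Opens}
    (hV : IsAffineOpen V) :
    Nonempty (M.restrict V.ι ≅ freeModule V r) ↔
      IsQCohAt M V ∧ Nonempty (Γ(M, V) ≃ₗ[Γ(X, V)] (Fin r → Γ(X, V))) := by
  have h₁ : Nonempty (M.restrict V.ι ≅ freeModule V r) ↔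
      Nonempty (M.restrict hV.fromSpec ≅ freeModule (Spec Γ(X, V)) r) :=
    ⟨nonempty_restrict_iso_freeModule_of_comp _ _ hV.isoSpec.inv hV.isoSpec_inv_ι,
      nonempty_restrict_iso_freeModule_of_comp _ _ hV.isoSpec.hom
        (by rw [← hV.isoSpec_inv_ι, Iso.hom_inv_id_assoc])⟩
  let e := restrictSectionsEquiv hV M ⊤ (V := V) (by simp)
  let e' : Γ(M.restrict hV.fromSpec, ⊤) ≃ₗ[Γ(X, V)] Γ(M, V) :=
    { e with
      map_smul' := fun r x ↦
        (restrictSectionsEquiv_smul hV M _ _ le_rfl r x).trans (congrArg (· • e x) (by simp)) }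
  rw [h₁, nonempty_iso_freeModule_iff, isQCohAt_iff hV]
  exact and_congr_right fun _ ↦ ⟨fun ⟨a⟩ ↦ ⟨e'.symm ≪≫ₗ a⟩, fun ⟨a⟩ ↦ ⟨e' ≪≫ₗ a⟩⟩

end Free

end ToricFrobenius

namespace ToricFrobenius

/-! ### Ranks of projective modules over a domain -/

section Algebra

open Module

/-- A module over a domain which is free of rank `r` locally on the spectrum is finite projective of
rank `r`: finite presentation and flatness are local. -/
lemma finite_projective_of_localizationSpan {R M : Type*} [CommRing R] [IsDomain R]
    [AddCommGroup M] [Module R M] {r : ℕ} (s : Set R) (hs : Ideal.span s = ⊤)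
    (Rₛ Mₛ : s → Type*) [∀ g, CommRing (Rₛ g)] [∀ g, Algebra R (Rₛ g)]
    [∀ g : s, IsLocalization.Away g.1 (Rₛ g)] [∀ g, AddCommGroup (Mₛ g)] [∀ g, Module R (Mₛ g)]
    [∀ g, Module (Rₛ g) (Mₛ g)] [∀ g, IsScalarTower R (Rₛ g) (Mₛ g)] (φ : ∀ g, M →ₗ[R] Mₛ g)
    [∀ g : s, IsLocalizedModule (Submonoid.powers g.1) (φ g)]
    (e : ∀ g, Nonempty (Mₛ g ≃ₗ[Rₛ g] (Fin r → Rₛ g))) :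
    Module.Finite R M ∧ Projective R M ∧ finrank R M = r := by
  have h1 : ∀ g, Module.Free (Rₛ g) (Mₛ g) := fun g ↦ .of_equiv (e g).some.symm
  have h2 : ∀ g, Module.Finite (Rₛ g) (Mₛ g) := fun g ↦ .equiv (e g).some.symm
  have hfp : FinitePresentation R M := .of_localizationSpan' s hs φ fun g ↦
    finitePresentation_of_projective (Rₛ g) (Mₛ g)
  have : Flat R M := by
    refine flat_of_isLocalized_span R M s hs Mₛ φ fun g ↦ ?_
    have : Flat R (Rₛ g) := IsLocalization.flat _ (Submonoid.powers g.1)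
    exact Flat.trans R (Rₛ g) (Mₛ g)
  refine ⟨inferInstance, Flat.projective_of_finitePresentation, ?_⟩
  obtain ⟨g, hg⟩ : ∃ g : s, g.1 ≠ 0 := by
    by_contra! h
    have : Ideal.span s ≤ ⊥ := Ideal.span_le.mpr fun g hg ↦ h ⟨g, hg⟩
    exact bot_ne_top (le_bot_iff.mp (hs ▸ this)).symm
  have hp : Submonoid.powers g.1 ≤ nonZeroDivisors R :=
    powers_le_nonZeroDivisors_of_noZeroDivisors hg
  have : Nontrivial (Rₛ g) := (IsLocalization.injective (Rₛ g) hp).nontrivial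
  rw [← IsLocalizedModule.finrank_eq _ (φ g) hp, ← IsLocalization.finrank_eq (Rₛ g) _ hp,
    (e g).some.finrank_eq, finrank_fin_fun]

/-- A finite projective module over a domain is free on some `D(f)` around a given prime. This is
stated for every model of the localization at `f`, in order to apply to sections over `D(f)`. -/
lemma exists_linearEquiv_of_projective (R M : Type u) [CommRing R] [IsDomain R] [AddCommGroup M]
    [Module R M] [Module.Finite R M] [Projective R M] (p : Ideal R) [p.IsPrime] :
    ∃ f ∉ p, ∀ (Rf : Type u) [CommRing Rf] [Algebra R Rf] [IsLocalization.Away f Rf] (Mf : Type u)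
      [AddCommGroup Mf] [Module R Mf] [Module Rf Mf] [IsScalarTower R Rf Mf] (φ : M →ₗ[R] Mf)
      [IsLocalizedModule (.powers f) φ], Nonempty (Mf ≃ₗ[Rf] (Fin (finrank R M) → Rf)) := by
  have : FinitePresentation R M := finitePresentation_of_projective R M
  have : Flat (Localization.AtPrime p) (LocalizedModule p.primeCompl M) := inferInstance
  have : Module.Free (Localization.AtPrime p) (LocalizedModule p.primeCompl M) :=
    free_of_flat_of_isLocalRing
  obtain ⟨f, hf, hfree, hrank⟩ := FinitePresentation.exists_free_localizedModule_powers
    p.primeCompl (LocalizedModule.mkLinearMap p.primeCompl M) (Localization.AtPrime p)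
  rw [IsLocalization.finrank_eq (Localization.AtPrime p) _ p.primeCompl_le_nonZeroDivisors,
    IsLocalizedModule.finrank_eq _ (LocalizedModule.mkLinearMap p.primeCompl M)
      p.primeCompl_le_nonZeroDivisors] at hrank
  refine ⟨f, hf, fun Rf _ _ _ Mf _ _ _ _ φ _ ↦ ?_⟩
  have h0 : f ≠ 0 := fun h ↦ hf (h ▸ p.zero_mem)
  have hp : Submonoid.powers f ≤ nonZeroDivisors R :=
    powers_le_nonZeroDivisors_of_noZeroDivisors h0
  have : Nontrivial (Localization.Away f) := (IsLocalization.injective _ hp).nontrivial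
  have : Nontrivial Rf := (IsLocalization.injective _ hp).nontrivial
  -- freeness over `Localization.Away f` is transported along `Localization.Away f ≃ Rf`
  let ε : Localization.Away f ≃ₐ[R] Rf := IsLocalization.algEquiv (.powers f) _ _
  let := ε.toRingHom.toAlgebra
  have : IsScalarTower R (Localization.Away f) Rf := .of_algebraMap_eq fun r ↦ (ε.commutes r).symm
  have : Module.Free (Localization.Away f) (TensorProduct R (Localization.Away f) M) :=
    .of_equiv (IsLocalizedModule.isBaseChange (.powers f) (Localization.Away f)
      (LocalizedModule.mkLinearMap (.powers f) M)).equiv.symm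
  have : Module.Free Rf Mf := .of_equiv
    (TensorProduct.AlgebraTensorModule.cancelBaseChange R (Localization.Away f) Rf Rf M ≪≫ₗ
      (IsLocalizedModule.isBaseChange (.powers f) Rf φ).equiv)
  have : Module.Finite Rf Mf := .of_isLocalizedModule (.powers f) (Rₚ := Rf) φ
  exact ⟨(finBasisOfFinrankEq Rf Mf (by
    rw [IsLocalization.finrank_eq Rf _ hp, IsLocalizedModule.finrank_eq _ φ hp])).equivFun⟩

lemma finrank_mul_finrank_le (R S P : Type*) [CommRing R] [CommRing S] [IsDomain R] [IsDomain S]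
    [Algebra R S] [AddCommGroup P] [Module R P] [Module S P] [IsScalarTower R S P]
    [Module.Finite R S] [Module.Free R S] [Module.Finite S P] :
    finrank R S * finrank S P ≤ finrank R P := by
  have : Module.Finite R P := .trans S P
  obtain ⟨v, hv⟩ := exists_linearIndependent_of_le_finrank (le_refl (finrank S P))
  have h := LinearMap.finrank_le_finrank_of_injective
    (f := (Fintype.linearCombination S v).restrictScalars R)
    (linearIndependent_iff_injective_fintypeLinearCombination.mp hv)
  rwa [finrank_pi_fintype, Finset.sum_const, Finset.card_univ, Fintype.card_fin, smul_eq_mul,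
    mul_comm] at h

/-- Tower law for the rank of a projective module: a complement of `P` in a free module satisfies
the same inequality, and the sum of both is an equality. -/
lemma finrank_mul_finrank_of_projective (R S P : Type*) [CommRing R] [CommRing S] [IsDomain R]
    [IsDomain S] [Algebra R S] [AddCommGroup P] [Module R P] [Module S P] [IsScalarTower R S P]
    [Module.Finite R S] [Module.Free R S] [Module.Finite S P] [Projective S P] :
    finrank R S * finrank S P = finrank R P := by
  have : Module.Finite R P := .trans S P
  obtain ⟨n, π, hπ⟩ := Module.Finite.exists_fin' S P
  obtain ⟨ι, hι⟩ := projective_lifting_property π LinearMap.id hπ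
  have hι' : Function.Injective ι := fun x y h ↦ by
    simpa using (LinearMap.congr_fun hι x).symm.trans
      ((congrArg π h).trans (LinearMap.congr_fun hι y))
  let Q := (Fin n → S) ⧸ LinearMap.range ι
  have h₁ : finrank S Q + finrank S P = n := by
    rw [← LinearMap.finrank_range_of_inj hι', Submodule.finrank_quotient_add_finrank,
      finrank_fin_fun]
  have h₂ : finrank R Q + finrank R P = n * finrank R S := by
    rw [← LinearMap.finrank_range_of_inj (f := ι.restrictScalars R) hι']
    refine (Submodule.finrank_quotient_add_finrank (LinearMap.range
      (ι.restrictScalars R))).trans ?_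
    rw [finrank_pi_fintype, Finset.sum_const, Finset.card_univ, Fintype.card_fin, smul_eq_mul]
  have h₃ := finrank_mul_finrank_le R S P
  have h₄ := finrank_mul_finrank_le R S Q
  have h₅ : n * finrank R S = finrank R S * finrank S Q + finrank R S * finrank S P := by
    rw [← Nat.mul_add, h₁, mul_comm]
  omega

end Algebra

end ToricFrobenius

namespace ToricFrobenius
/-! ### Vector bundles and projective modules -/

open Scheme.Modules

section LocallyFree

variable {X : Scheme.{u}} {U : X.Opens}

/-- The sections of a module over `D(f) ⊆ U`, as a module over the functions on `U`. -/
noncomputable abbrev basicOpenModule (M : X.Modules) (f : Γ(X, U)) :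
    Module Γ(X, U) Γ(M, X.basicOpen f) :=
  Module.compHom _ (X.presheaf.map (homOfLE (X.basicOpen_le f)).op).hom

attribute [local instance] basicOpenModule

instance basicOpen_isScalarTower (M : X.Modules) (f : Γ(X, U)) :
    IsScalarTower Γ(X, U) Γ(X, X.basicOpen f) Γ(M, X.basicOpen f) :=
  .of_algebraMap_smul fun _ _ ↦ rfl

/-- The restriction of sections from `U` to `D(f)`, as a linear map. -/
noncomputable def resBasicOpen (M : X.Modules) (f : Γ(X, U)) :
    Γ(M, U) →ₗ[Γ(X, U)] Γ(M, X.basicOpen f) where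
  toFun := M.presheaf.map (homOfLE (X.basicOpen_le f)).op
  map_add' := map_add _
  map_smul' r x := M.map_smul _ r x

lemma IsQCohAt.isLocalizedModule {M : X.Modules} (hU : IsAffineOpen U) (h : IsQCohAt M U)
    (f : Γ(X, U)) : IsLocalizedModule (.powers f) (resBasicOpen M f) := by
  obtain ⟨h₁, h₂⟩ := h f _ rfl (X.basicOpen_le f)
  refine IsLocalizedModule.Away.mk_of_addCommGroup ?_ ?_ h₂
  · have := hU.isLocalization_basicOpen f
    have hu := (IsLocalization.Away.algebraMap_isUnit (S := Γ(X, X.basicOpen f)) f).map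
      (algebraMap Γ(X, X.basicOpen f) (Module.End Γ(X, X.basicOpen f) Γ(M, X.basicOpen f)))
    rw [Module.End.isUnit_iff] at hu ⊢
    exact hu
  · intro s
    obtain ⟨n, t, ht⟩ := h₁ s
    refine ⟨n, t, Eq.trans ?_ ht.symm⟩
    rw [← map_pow]
    rfl

/-- Over an affine open subset, the sections of a vector bundle of rank `r` are a finite projective
module of rank `r`. -/
lemma finite_projective_sections (hU : IsAffineOpen U) [IsDomain Γ(X, U)] {M : X.Modules} {r : ℕ}
    (hM : IsQCohAt M U)
    (h : ∀ x ∈ U, ∃ W : X.Opens, x ∈ W ∧ Nonempty (M.restrict W.ι ≅ freeModule W r)) :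
    Module.Finite Γ(X, U) Γ(M, U) ∧ Module.Projective Γ(X, U) Γ(M, U) ∧
      Module.finrank Γ(X, U) Γ(M, U) = r := by
  let s : Set Γ(X, U) :=
    {f | Nonempty (M.restrict (X.basicOpen f).ι ≅ freeModule (X.basicOpen f) r)}
  have hs : Ideal.span s = ⊤ := by
    rw [← hU.iSup_basicOpen_eq_self_iff]
    refine le_antisymm (iSup_le fun f ↦ X.basicOpen_le _) fun x hx ↦ ?_
    obtain ⟨W, hxW, e⟩ := h x hx
    obtain ⟨f, hfW, hxf⟩ := hU.exists_basicOpen_le ⟨x, hxW⟩ hx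
    exact TopologicalSpace.Opens.mem_iSup.mpr
      ⟨⟨f, nonempty_restrict_iso_freeModule_of_le hfW e⟩, hxf⟩
  have := hU.isLocalization_basicOpen
  have := hM.isLocalizedModule hU
  exact finite_projective_of_localizationSpan s hs (fun f ↦ Γ(X, X.basicOpen f.1))
    (fun f ↦ Γ(M, X.basicOpen f.1)) (fun f ↦ resBasicOpen M f.1) fun f ↦
    ((nonempty_restrict_iso_freeModule_iff (hU.basicOpen f.1)).mp f.2).2

/-- Conversely, a quasi-coherent module whose sections over an affine open subset `U` are finite
projective is locally trivial on `U`. -/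
lemma exists_restrict_iso_freeModule (hU : IsAffineOpen U) [IsDomain Γ(X, U)] {M : X.Modules}
    (hM : IsQCohAt M U) [Module.Finite Γ(X, U) Γ(M, U)] [Module.Projective Γ(X, U) Γ(M, U)]
    {x : X} (hx : x ∈ U) : ∃ W : X.Opens, x ∈ W ∧
      Nonempty (M.restrict W.ι ≅ freeModule W (Module.finrank Γ(X, U) Γ(M, U))) := by
  obtain ⟨f, hf, H⟩ := exists_linearEquiv_of_projective Γ(X, U) Γ(M, U)
    (hU.primeIdealOf ⟨x, hx⟩).asIdeal
  have := hU.isLocalization_basicOpen f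
  have := hM.isLocalizedModule hU f
  have hxf : x ∈ X.basicOpen f := by
    have : hU.primeIdealOf ⟨x, hx⟩ ∈ hU.fromSpec ⁻¹ᵁ X.basicOpen f := by
      rw [hU.fromSpec_preimage_basicOpen]
      exact hf
    change hU.fromSpec (hU.primeIdealOf ⟨x, hx⟩) ∈ X.basicOpen f at this
    rwa [hU.fromSpec_primeIdealOf] at this
  exact ⟨X.basicOpen f, hxf, (nonempty_restrict_iso_freeModule_iff (hU.basicOpen f)).mpr
    ⟨hM.of_le hU (hU.basicOpen f) (X.basicOpen_le f), H _ _ (resBasicOpen M f)⟩⟩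

lemma IsVectorBundle.isQCohAt {M : X.Modules} (hM : IsVectorBundle M) (hU : IsAffineOpen U) :
    IsQCohAt M U := by
  have := isQuasicoherent_of_isVectorBundle hM
  rw [isQCohAt_iff hU]
  exact Scheme.Modules.isQuasicoherent_restrictFunctor hU.fromSpec M

/-- On an integral scheme the rank of a vector bundle is constant: two non-empty open subsets
intersect. -/
lemma IsVectorBundle.exists_isVectorBundleOfRank [IsIntegral X] {M : X.Modules}
    (hM : IsVectorBundle M) :
    ∃ r, IsVectorBundleOfRank M r := by
  obtain ⟨U₀, r, hx₀, e₀⟩ := hM (genericPoint X)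
  refine ⟨r, fun x ↦ ?_⟩
  obtain ⟨U, r', hx, e⟩ := hM x
  have hη : genericPoint X ∈ U := (genericPoint_spec X).mem_open_set_iff U.2 |>.mpr ⟨x, trivial, hx⟩
  obtain ⟨_, ⟨V, hV, rfl⟩, hηV, hVU⟩ :=
    X.isBasis_affineOpens.exists_subset_of_mem_open
      (show genericPoint X ∈ U ⊓ U₀ from ⟨hη, hx₀⟩) (U ⊓ U₀).2
  have : Nonempty V := ⟨⟨_, hηV⟩⟩
  obtain ⟨-, ⟨a⟩⟩ := (nonempty_restrict_iso_freeModule_iff hV).mp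
    (nonempty_restrict_iso_freeModule_of_le (hVU.trans inf_le_left) e)
  obtain ⟨-, ⟨b⟩⟩ := (nonempty_restrict_iso_freeModule_iff hV).mp
    (nonempty_restrict_iso_freeModule_of_le (hVU.trans inf_le_right) e₀)
  have hr := (a.symm ≪≫ₗ b).finrank_eq
  rw [Module.finrank_fin_fun, Module.finrank_fin_fun] at hr
  exact ⟨U, hx, hr ▸ e⟩

end LocallyFree

end ToricFrobenius

namespace ToricFrobenius

/-! ### Polynomial rings over their subrings of polynomials in `m`-th powers -/

section Expand

open MvPolynomial

variable {σ k : Type*} [CommRing k] {m : ℕ}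

/-- The exponent vector with entries `a i < m`. -/
noncomputable def residueExponent [Finite σ] (a : σ → Fin m) : σ →₀ ℕ :=
  Finsupp.equivFunOnFinite.symm fun i ↦ (a i : ℕ)

@[simp] lemma residueExponent_apply [Finite σ] (a : σ → Fin m) (i : σ) :
    residueExponent a i = a i := rfl

lemma coeff_expand_mul_monomial [Finite σ] [DecidableEq (σ → Fin m)] (hm : 0 < m)
    (p : MvPolynomial σ k) (a b : σ → Fin m) (q : σ →₀ ℕ) :
    coeff (m • q + residueExponent b) (expand m p * monomial (residueExponent a) 1) =
      if a = b then coeff q p else 0 := by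
  rw [coeff_mul_monomial', mul_one]
  split_ifs with h1 h2 h2
  · rw [h2, add_tsub_cancel_right, coeff_expand_smul _ hm.ne']
  · obtain ⟨i, hi⟩ := Function.ne_iff.mp h2
    refine coeff_expand_of_not_dvd (i := i) _ fun ⟨c, hc⟩ ↦ hi ?_
    have h3 := h1 i
    simp only [Finsupp.tsub_apply, Finsupp.add_apply, Finsupp.smul_apply, smul_eq_mul,
      residueExponent_apply] at hc h3
    have h4 : m * q i + b i = m * c + a i := by omega
    have h5 := congrArg (· % m) h4
    simp only [Nat.mul_add_mod, Nat.mod_eq_of_lt (a i).2, Nat.mod_eq_of_lt (b i).2] at h5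
    exact Fin.ext h5.symm
  · refine absurd ?_ h1
    rw [h2]
    exact le_add_self
  · rfl

/-- The monomials with all exponents smaller than `m` are a basis of the polynomial ring over the
subring of polynomials in the `m`-th powers of the variables. -/
lemma bijective_sum_expand_mul_monomial [Fintype σ] [DecidableEq σ] (hm : 0 < m) :
    Function.Bijective fun c : (σ → Fin m) → MvPolynomial σ k ↦
      ∑ a, expand m (c a) * monomial (residueExponent a) 1 := by
  have hcoeff (c : (σ → Fin m) → MvPolynomial σ k) (b : σ → Fin m) (q : σ →₀ ℕ) :
      coeff (m • q + residueExponent b)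
        (∑ a, expand m (c a) * monomial (residueExponent a) 1) = coeff q (c b) := by
    rw [coeff_sum, Finset.sum_congr rfl fun a _ ↦ coeff_expand_mul_monomial hm (c a) a b q]
    simp
  refine ⟨fun c c' h ↦ funext fun b ↦ MvPolynomial.ext _ _ fun q ↦ ?_, fun p ↦ ?_⟩
  · rw [← hcoeff, ← hcoeff]
    exact congrArg _ h
  · induction p using MvPolynomial.induction_on' with
    | monomial e r =>
      refine ⟨Pi.single (fun i ↦ ⟨e i % m, Nat.mod_lt _ hm⟩)
        (monomial (e.mapRange (· / m) (Nat.zero_div m)) r), ?_⟩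
      change ∑ a, _ = _
      rw [Finset.sum_eq_single (fun i ↦ (⟨e i % m, Nat.mod_lt _ hm⟩ : Fin m))]
      · rw [Pi.single_eq_same, expand_monomial, monomial_mul, mul_one]
        refine congrArg (monomial · r) (Finsupp.ext fun i ↦ ?_)
        simp [Nat.div_add_mod]
      · intro b _ hb
        rw [Pi.single_eq_of_ne hb, map_zero, zero_mul]
      · simp
    | add p q hp hq =>
      obtain ⟨c, rfl⟩ := hp
      obtain ⟨c', rfl⟩ := hq
      exact ⟨c + c', by simp [add_mul, Finset.sum_add_distrib]⟩

/-- A ring homomorphism which is isomorphic to `xᵢ ↦ xᵢ ^ m` on a polynomial ring makes its target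
a finite free module over its source. -/
lemma free_of_expand {R S : Type*} [CommRing R] [CommRing S] [Algebra R S] [Fintype σ]
    [Nontrivial R] (hm : 0 < m)
    (D₁ : R →+* MvPolynomial σ k) (hD₁ : Function.Bijective D₁)
    (D₂ : S →+* MvPolynomial σ k) (hD₂ : Function.Bijective D₂)
    (h : ∀ x, D₂ (algebraMap R S x) = expand m (D₁ x)) :
    Module.Free R S ∧ Module.Finite R S ∧ Module.finrank R S = m ^ Fintype.card σ := by
  classical
  choose v hv using fun a : σ → Fin m ↦ hD₂.2 (monomial (residueExponent a) 1)
  let T : ((σ → Fin m) → R) →ₗ[R] S := Fintype.linearCombination R v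
  have hT (c : (σ → Fin m) → R) :
      D₂ (T c) = ∑ a, expand m (D₁ (c a)) * monomial (residueExponent a) 1 := by
    simp [T, Fintype.linearCombination_apply, Algebra.smul_def, h, hv]
  have hbij : Function.Bijective T := by
    refine (hD₂.of_comp_iff' T).mp ?_
    rw [show D₂ ∘ T = (fun c : (σ → Fin m) → MvPolynomial σ k ↦
      ∑ a, expand m (c a) * monomial (residueExponent a) 1) ∘ (D₁ ∘ ·) from funext hT]
    exact (bijective_sum_expand_mul_monomial hm).comp
      ⟨hD₁.1.comp_left, hD₁.2.comp_left⟩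
  let e := LinearEquiv.ofBijective T hbij
  exact ⟨.of_equiv e, .equiv e, by simp [← e.finrank_eq]⟩

end Expand

/-! ### Dehomogenization -/

section Dehomogenize

open MvPolynomial

attribute [local instance] MvPolynomial.gradedAlgebra

lemma eval_smul_of_isHomogeneous {ι k : Type*} [CommRing k] {p : MvPolynomial ι k} {N : ℕ}
    (hp : p.IsHomogeneous N) (c : k) (x : ι → k) : eval (c • x) p = c ^ N * eval x p := by
  rw [eval_eq, eval_eq, Finset.mul_sum]
  refine Finset.sum_congr rfl fun e he ↦ ?_
  have h1 : ∑ j ∈ e.support, e j = N := (hp.degree_eq_sum_deg_support he).symm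
  simp only [Pi.smul_apply, smul_eq_mul, mul_pow, Finset.prod_mul_distrib]
  rw [Finset.prod_pow_eq_pow_sum, h1]
  ring

variable {ι k : Type*} [DecidableEq ι]

/-- Dehomogenization with respect to `xᵢ`: the substitution `xᵢ ↦ 1`. -/
noncomputable def dehomogenize [CommRing k] (i : ι) :
    MvPolynomial ι k →ₐ[k] MvPolynomial {l // l ≠ i} k :=
  aeval fun l ↦ if h : l = i then 1 else X ⟨l, h⟩

section

variable [CommRing k] (i : ι)

@[simp] lemma dehomogenize_X_self : dehomogenize i (X i : MvPolynomial ι k) = 1 := by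
  simp [dehomogenize]

lemma dehomogenize_X_of_ne {l : ι} (h : l ≠ i) :
    dehomogenize i (X l : MvPolynomial ι k) = X ⟨l, h⟩ := by
  simp [dehomogenize, h]

lemma eval_dehomogenize (y : ι → k) (hy : y i = 1) (p : MvPolynomial ι k) :
    eval (fun l : {l // l ≠ i} ↦ y l) (dehomogenize i p) = eval y p := by
  induction p using MvPolynomial.induction_on with
  | C a => simp
  | add p q hp hq => simp [hp, hq]
  | mul_X p l hp =>
    rw [map_mul, map_mul, map_mul, hp, eval_X]
    congr 1
    by_cases h : l = i
    · subst h
      simp [hy]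
    · rw [dehomogenize_X_of_ne i h, eval_X]

lemma dehomogenize_ne_zero_of_prod_X [IsDomain k] [Fintype ι] (b : ι → ℕ) :
    dehomogenize i (∏ l, (X l : MvPolynomial ι k) ^ b l) ≠ 0 := by
  rw [map_prod, Finset.prod_ne_zero_iff]
  intro l _
  rw [map_pow]
  refine pow_ne_zero _ ?_
  by_cases h : l = i
  · subst h
    simp
  · rw [dehomogenize_X_of_ne i h]
    exact X_ne_zero _

end

/-- Over an infinite field this holds because `xᵢ p` vanishes at every point: where `xᵢ ≠ 0`, scale
to `xᵢ = 1`. -/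
lemma eq_zero_of_dehomogenize_eq_zero [Field k] [Infinite k] (i : ι) {p : MvPolynomial ι k}
    {N : ℕ} (hp : p.IsHomogeneous N) (h : dehomogenize i p = 0) : p = 0 := by
  have h1 : X i * p = 0 := by
    refine MvPolynomial.funext fun x ↦ ?_
    rw [map_mul, eval_X, map_zero]
    by_cases hx : x i = 0
    · rw [hx, zero_mul]
    · have h2 : x = x i • ((x i)⁻¹ • x) := by rw [smul_smul, mul_inv_cancel₀ hx, one_smul]
      have h3 : eval ((x i)⁻¹ • x) p = 0 := by
        rw [← eval_dehomogenize i _ (by simp [hx]), h, map_zero]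
      rw [h2, eval_smul_of_isHomogeneous hp, h3, mul_zero, mul_zero]
  exact (mul_eq_zero.mp h1).resolve_left (X_ne_zero i)

lemma awayLift_mk_pow {A B : Type*} [CommRing A] [CommRing B] (f : A →+* B) (s : A)
    (hs : f s = 1) (a : A) (j : ℕ) :
    Localization.awayLift f s (hs ▸ isUnit_one) (Localization.mk a ⟨s ^ j, j, rfl⟩) = f a := by
  rw [Localization.awayLift_mk (hv := by rw [hs, one_mul])]
  simp

variable [Field k] (i : ι) (s : MvPolynomial ι k)

open HomogeneousLocalization

/-- Dehomogenization on the coordinate ring of `D₊(s)`, for `s` with `s = 1` under `xᵢ ↦ 1`: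
the fraction `a / s ^ j` is sent to the dehomogenization of `a`. -/
noncomputable def awayDehomogenize (hs : dehomogenize i s = 1) :
    Away (homogeneousSubmodule ι k) s →+* MvPolynomial {l // l ≠ i} k :=
  (Localization.awayLift (dehomogenize i).toRingHom s (hs ▸ isUnit_one)).comp
    (algebraMap (Away (homogeneousSubmodule ι k) s) (Localization.Away s))

variable {i s}

lemma awayDehomogenize_of_val_eq_mk (hs : dehomogenize i s = 1)
    {z : Away (homogeneousSubmodule ι k) s} {a : MvPolynomial ι k} {j : ℕ}
    (h : z.val = Localization.mk a (⟨s ^ j, j, rfl⟩ : Submonoid.powers s)) :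
    awayDehomogenize i s hs z = dehomogenize i a := by
  have hs' : IsUnit ((dehomogenize i).toRingHom s) := hs ▸ isUnit_one
  exact (congrArg (Localization.awayLift (dehomogenize i).toRingHom s hs') h).trans
    (awayLift_mk_pow (dehomogenize i).toRingHom s hs a j)

/-- Dehomogenization identifies the coordinate ring of `D₊(s)`, `s` a power of `xᵢ`, with a
polynomial ring in one variable less. -/
lemma bijective_awayDehomogenize [Infinite k] (hs : dehomogenize i s = 1) {d : ℕ} (hd : 0 < d)
    (hsd : s ∈ homogeneousSubmodule ι k d) : Function.Bijective (awayDehomogenize i s hs) := by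
  refine ⟨(injective_iff_map_eq_zero _).mpr fun z hz ↦ ?_, fun p ↦ ?_⟩
  · obtain ⟨j, a, ha, rfl⟩ := Away.mk_surjective _ hsd z
    rw [awayDehomogenize_of_val_eq_mk hs (Away.val_mk ..)] at hz
    have h0 : a = 0 := eq_zero_of_dehomogenize_eq_zero i ha hz
    refine val_injective _ ?_
    simp [Away.val_mk, h0, Localization.mk_zero]
  · change p ∈ (awayDehomogenize i s hs).range
    induction p using MvPolynomial.induction_on with
    | C c =>
      refine ⟨Away.mk _ hsd 0 (C c) ?_, ?_⟩
      · rw [zero_smul]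
        exact isHomogeneous_C _ _
      · rw [awayDehomogenize_of_val_eq_mk hs (Away.val_mk ..)]
        simp
    | add p q hp hq => exact add_mem hp hq
    | mul_X p l hp =>
      refine mul_mem hp ⟨Away.mk _ hsd 1 (X l.1 * X i ^ (d - 1)) ?_, ?_⟩
      · have := (isHomogeneous_X k l.1).mul (isHomogeneous_X_pow i (d - 1))
        rw [one_smul]
        rwa [Nat.add_sub_cancel' hd] at this
      · rw [awayDehomogenize_of_val_eq_mk hs (Away.val_mk ..), map_mul, map_pow,
          dehomogenize_X_self, one_pow, mul_one, dehomogenize_X_of_ne]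

lemma awayDehomogenize_awayScale {f : MvPolynomial ι k →+* MvPolynomial ι k} {d : ℕ}
    (hf : IsScaling (homogeneousSubmodule ι k) (homogeneousSubmodule ι k) d f)
    (hfs : dehomogenize i (f s) = 1)
    {z : Away (homogeneousSubmodule ι k) s} {a : MvPolynomial ι k} {j : ℕ}
    (h : z.val = Localization.mk a (⟨s ^ j, j, rfl⟩ : Submonoid.powers s)) :
    awayDehomogenize i (f s) hfs (awayScale hf s z) = dehomogenize i (f a) := by
  refine awayDehomogenize_of_val_eq_mk hfs (j := j) ?_
  rw [val_awayScale, h, locMap, Localization.mk_eq_mk', IsLocalization.map_mk',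
    Localization.mk_eq_mk']
  simp only [map_pow]

end Dehomogenize

end ToricFrobenius

namespace ToricFrobenius

/-! ### Sections over the standard charts of `Proj` -/

section Charts

/-- For a morphism `j : Spec A ⟶ X` with image in `V`, the pullback of functions from `V` to
`Spec A`. -/
noncomputable def chartSections {X : Scheme.{u}} {A : CommRingCat.{u}} (j : Spec A ⟶ X)
    (V : X.Opens) (h : ⊤ ≤ j ⁻¹ᵁ V) : Γ(X, V) →+* A :=
  (j.appLE V ⊤ h ≫ (Scheme.ΓSpecIso A).hom).hom

lemma bijective_chartSections {X : Scheme.{u}} {A : CommRingCat.{u}} (j : Spec A ⟶ X)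
    [IsOpenImmersion j] (V : X.Opens) (hV : V = j.opensRange) (h : ⊤ ≤ j ⁻¹ᵁ V) :
    Function.Bijective (chartSections j V h) := by
  obtain rfl : V = j ''ᵁ ⊤ := hV.trans j.image_top_eq_opensRange.symm
  have : IsIso (j.appLE (j ''ᵁ ⊤) ⊤ h) := by
    rw [← j.appIso_hom']
    infer_instance
  exact ConcreteCategory.bijective_of_isIso (j.appLE (j ''ᵁ ⊤) ⊤ h ≫ (Scheme.ΓSpecIso A).hom)

lemma chartSections_appLE {X Y : Scheme.{u}} {A B : CommRingCat.{u}} {j : Spec A ⟶ X}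
    {j' : Spec B ⟶ Y} {F : Y ⟶ X} {φ : A ⟶ B} (H : j' ≫ F = Spec.map φ ≫ j)
    {V : X.Opens} (h : ⊤ ≤ j ⁻¹ᵁ V) {W : Y.Opens} (h' : ⊤ ≤ j' ⁻¹ᵁ W) (hVW : W ≤ F ⁻¹ᵁ V)
    (y : Γ(X, V)) :
    chartSections j' W h' (F.appLE V W hVW y) = φ (chartSections j V h y) := by
  have key : F.appLE V W hVW ≫ j'.appLE W ⊤ h' ≫ (Scheme.ΓSpecIso B).hom =
      (j.appLE V ⊤ h ≫ (Scheme.ΓSpecIso A).hom) ≫ φ := by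
    rw [← Category.assoc, Scheme.Hom.appLE_comp_appLE, Category.assoc,
      ← Scheme.ΓSpecIso_naturality, ← Category.assoc]
    congr 1
    have h1 : (Spec.map φ).appTop = (Spec.map φ).appLE ⊤ ⊤ le_top := by
      simp [Scheme.Hom.app_eq_appLE]
    rw [h1]
    have aux {f g : Spec B ⟶ X} (hfg : f = g) (hf hg) : f.appLE V ⊤ hf = g.appLE V ⊤ hg := by
      subst hfg
      rfl
    exact (aux H _ _).trans (Scheme.Hom.appLE_comp_appLE _ _ _ _ _ _ _).symm
  exact congrArg (fun f ↦ f.hom y) key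

end Charts

section ProjCharts

open HomogeneousLocalization

variable {A B : Type u} {σ τ : Type u} [CommRing A] [CommRing B]
  [SetLike σ A] [AddSubgroupClass σ A] [SetLike τ B] [AddSubgroupClass τ B]
  {𝒜 : ℕ → σ} {ℬ : ℕ → τ} [GradedRing 𝒜] [GradedRing ℬ] {d : ℕ} {f : A →+* B}

lemma top_le_awayι_preimage {i : ℕ} {s : A} (hs : s ∈ 𝒜 i) (hi : 0 < i) {V : (Proj 𝒜).Opens}
    (hV : V = Proj.basicOpen 𝒜 s) : ⊤ ≤ Proj.awayι 𝒜 s hs hi ⁻¹ᵁ V := by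
  subst hV
  rw [← Proj.opensRange_awayι 𝒜 s hs hi, Scheme.Hom.preimage_opensRange]

/-- A degree-scaling homomorphism `f` satisfies `D₊(f s) = F⁻¹ D₊(s)` for the induced morphism `F`
of projective spectra. -/
lemma projScale_preimage_basicOpen (hf : IsScaling 𝒜 ℬ d f) {j : ℕ} (hj : 0 < j) {a : A}
    (ha : a ∈ 𝒜 j) : projScale hf ⁻¹ᵁ Proj.basicOpen 𝒜 a = Proj.basicOpen ℬ (f a) := by
  have key {i : ℕ} (hi : 0 < i) (s : A) (hs : s ∈ 𝒜 i) :
      Proj.awayι ℬ (f s) (hf.map_mem _ _ hs) (Nat.mul_pos hf.pos hi) ⁻¹ᵁ projScale hf ⁻¹ᵁ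
        Proj.basicOpen 𝒜 a =
      Proj.awayι ℬ (f s) (hf.map_mem _ _ hs) (Nat.mul_pos hf.pos hi) ⁻¹ᵁ
        Proj.basicOpen ℬ (f a) := by
    rw [← Scheme.Hom.comp_preimage, awayι_projScale hf hi s hs, Scheme.Hom.comp_preimage,
      Proj.awayι_preimage_basicOpen 𝒜 hs hi ha hj,
      Proj.awayι_preimage_basicOpen ℬ _ _ (hf.map_mem _ _ ha) (Nat.mul_pos hf.pos hj)]
    have h1 : Away.isLocalizationElem (hf.map_mem _ _ hs) (hf.map_mem _ _ ha) =
        awayScale hf s (Away.isLocalizationElem hs ha) ^ d := by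
      refine val_injective _ ?_
      rw [val_pow, val_awayScale, Away.isLocalizationElem, Away.val_mk, Away.isLocalizationElem,
        Away.val_mk, locMap, Localization.mk_eq_mk', Localization.mk_eq_mk',
        IsLocalization.map_mk', ← IsLocalization.mk'_pow]
      congr 1
      · simp [← pow_mul, mul_comm]
      · refine Subtype.ext ?_
        simp [← pow_mul, mul_comm]
    rw [h1, PrimeSpectrum.basicOpen_pow _ _ hf.pos]
    rfl
  ext x
  obtain ⟨s, z, rfl⟩ := (scaleCover hf).openCover.exists_eq x
  exact iff_of_eq (congrArg (z ∈ ·) (key s.1.2 s.2.1 s.2.2))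

end ProjCharts

end ToricFrobenius

namespace ToricFrobenius

/-! ### Projective space -/

section ProjSpaceCharts

open MvPolynomial HomogeneousLocalization

attribute [local instance] MvPolynomial.gradedAlgebra

section Integral

variable (n : ℕ) (k : Type u) [Field k]

/-- The generic point of projective space, the zero ideal. -/
noncomputable def genericIdeal : ProjectiveSpectrum (homogeneousSubmodule (Fin (n + 1)) k) where
  asHomogeneousIdeal := ⊥
  isPrime := by
    rw [HomogeneousIdeal.toIdeal_bot]
    exact Ideal.isPrime_bot
  not_irrelevant_le h := by
    have h1 := HomogeneousIdeal.mem_irrelevant_of_mem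
      (homogeneousSubmodule (Fin (n + 1)) k) one_pos (isHomogeneous_X k 0)
    have h2 : (X 0 : MvPolynomial (Fin (n + 1)) k) ∈
      (⊥ : HomogeneousIdeal (homogeneousSubmodule (Fin (n + 1)) k)) := h h1
    exact X_ne_zero 0 ((HomogeneousIdeal.mem_iff).mp h2)

/-- The zero ideal lies in every non-empty open subset, and the homogeneous localizations embed into
localizations of a polynomial ring. -/
instance isIntegral_projSpace : IsIntegral (ProjSpace n k) := by
  have : Nonempty (ProjSpace n k) := ⟨genericIdeal n k⟩
  have hgen (U : (ProjSpace n k).Opens) (hU : (U : Set (ProjSpace n k)).Nonempty) :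
      genericIdeal n k ∈ U := by
    obtain ⟨x, hx⟩ := hU
    obtain ⟨_, ⟨f, rfl⟩, hxf, hfU⟩ :=
      (ProjectiveSpectrum.isTopologicalBasis_basic_opens
        (homogeneousSubmodule (Fin (n + 1)) k)).exists_subset_of_mem_open hx U.2
    refine hfU fun hf ↦ hxf ?_
    rw [show f = 0 from HomogeneousIdeal.mem_iff.mp hf]
    exact zero_mem _
  have : IrreducibleSpace (ProjSpace n k) :=
    { toNonempty := this
      isPreirreducible_univ := fun U V hU hV hUU hVV ↦
        ⟨genericIdeal n k, Set.mem_univ _, hgen ⟨U, hU⟩ (by simpa using hUU),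
          hgen ⟨V, hV⟩ (by simpa using hVV)⟩ }
  have : IsReduced (ProjSpace n k) := by
    have (i : (Proj.affineOpenCover (homogeneousSubmodule (Fin (n + 1)) k)).openCover.I₀) :
        IsReduced ((Proj.affineOpenCover
          (homogeneousSubmodule (Fin (n + 1)) k)).openCover.X i) := by
      obtain ⟨⟨d, hd⟩, ⟨s, hs⟩⟩ := i
      have : _root_.IsReduced (Away (homogeneousSubmodule (Fin (n + 1)) k) s) := by
        exact isReduced_of_injective (algebraMap (Away (homogeneousSubmodule (Fin (n + 1)) k) s)
          (Localization.Away s)) (val_injective _)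
      exact inferInstanceAs
        (IsReduced (Spec (.of (Away (homogeneousSubmodule (Fin (n + 1)) k) s))))
    exact IsReduced.of_openCover (Proj _)
      (Proj.affineOpenCover (homogeneousSubmodule (Fin (n + 1)) k)).openCover
  exact isIntegral_of_irreducibleSpace_of_isReduced _

end Integral

variable {n : ℕ} {k : Type u} [Field k]

/-- The standard chart `xᵢ ≠ 0`. -/
noncomputable def standardChart (i : Fin (n + 1)) : (ProjSpace n k).Opens :=
  Proj.basicOpen (homogeneousSubmodule (Fin (n + 1)) k) (X i)

lemma isAffineOpen_standardChart (i : Fin (n + 1)) :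
    IsAffineOpen (standardChart i : (ProjSpace n k).Opens) :=
  Proj.isAffineOpen_basicOpen _ _ (isHomogeneous_X k i) one_pos

lemma exists_mem_standardChart (x : ProjSpace n k) : ∃ i, x ∈ standardChart i := by
  have hx : x ∈ ⨆ i : Fin (n + 1), Proj.basicOpen (homogeneousSubmodule (Fin (n + 1)) k) (X i) := by
    rw [Proj.iSup_basicOpen_eq_top' _ _ fun i ↦ ⟨1, isHomogeneous_X k i⟩]
    · trivial
    · refine Algebra.eq_top_iff.mpr fun p ↦ ?_
      induction p using MvPolynomial.induction_on with
      | C c =>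
        exact Subalgebra.algebraMap_mem _
          (⟨C c, isHomogeneous_C _ c⟩ : homogeneousSubmodule (Fin (n + 1)) k 0)
      | add p q hp hq => exact add_mem hp hq
      | mul_X p i hp => exact mul_mem hp (Algebra.subset_adjoin ⟨i, rfl⟩)
  exact TopologicalSpace.Opens.mem_iSup.mp hx

/-- Over `D₊(s)`, where `s` is homogeneous of degree `d` and `s = 1` for `xᵢ = 1`, regular functions
are polynomials in the variables `x_l / xᵢ`, `l ≠ i`. -/
noncomputable def chartCoord (i : Fin (n + 1)) {s : MvPolynomial (Fin (n + 1)) k} {d : ℕ}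
    (hs : dehomogenize i s = 1) (hd : 0 < d) (hsd : s ∈ homogeneousSubmodule (Fin (n + 1)) k d)
    (V : (ProjSpace n k).Opens)
    (hV : V = Proj.basicOpen (homogeneousSubmodule (Fin (n + 1)) k) s) :
    Γ(ProjSpace n k, V) →+* MvPolynomial {l // l ≠ i} k :=
  (awayDehomogenize i s hs).comp
    (chartSections (Proj.awayι _ s hsd hd) V (top_le_awayι_preimage hsd hd hV))

section

variable {i : Fin (n + 1)} {s : MvPolynomial (Fin (n + 1)) k} {d : ℕ}
    (hs : dehomogenize i s = 1) (hd : 0 < d) (hsd : s ∈ homogeneousSubmodule (Fin (n + 1)) k d)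
    {V : (ProjSpace n k).Opens}
    (hV : V = Proj.basicOpen (homogeneousSubmodule (Fin (n + 1)) k) s)

lemma bijective_chartSections_awayι : Function.Bijective
    (chartSections (X := ProjSpace n k) (Proj.awayι _ s hsd hd) V
      (top_le_awayι_preimage hsd hd hV)) :=
  have : IsOpenImmersion (X := Spec _) (Y := ProjSpace n k)
      (Proj.awayι (homogeneousSubmodule (Fin (n + 1)) k) s hsd hd) :=
    inferInstanceAs (IsOpenImmersion (Proj.awayι (homogeneousSubmodule (Fin (n + 1)) k) s hsd hd))
  bijective_chartSections _ _ (hV.trans (Proj.opensRange_awayι _ s hsd hd).symm) _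

lemma bijective_chartCoord [Infinite k] : Function.Bijective (chartCoord i hs hd hsd V hV) :=
  (bijective_awayDehomogenize hs hd hsd).comp (bijective_chartSections_awayι hd hsd hV)

lemma chartCoord_const (c : k) :
    chartCoord i hs hd hsd V hV (ProjSpace.const c V) = C c := by
  have h1 : chartSections (Proj.awayι _ s hsd hd) V (top_le_awayι_preimage hsd hd hV)
      (ProjSpace.const c V) =
      fromZeroRingHom (homogeneousSubmodule (Fin (n + 1)) k) (Submonoid.powers s)
        (algebraMap k (homogeneousSubmodule (Fin (n + 1)) k 0) c) := by
    have H : Proj.awayι (homogeneousSubmodule (Fin (n + 1)) k) s hsd hd ≫ ProjSpace.toSpec n k =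
        Spec.map (CommRingCat.ofHom (algebraMap k (homogeneousSubmodule (Fin (n + 1)) k 0)) ≫
          CommRingCat.ofHom (fromZeroRingHom (homogeneousSubmodule (Fin (n + 1)) k)
            (Submonoid.powers s))) ≫ 𝟙 (Spec (.of k)) := by
      rw [ProjSpace.toSpec, Category.comp_id, Spec.map_comp]
      exact Proj.awayι_toSpecZero_assoc _ _ hsd hd _
    have h2 := chartSections_appLE H (V := ⊤) le_top
      (top_le_awayι_preimage hsd hd hV) le_top ((Scheme.ΓSpecIso (.of k)).inv c)
    have h3 : chartSections (𝟙 (Spec (.of k))) ⊤ le_top ((Scheme.ΓSpecIso (.of k)).inv c) = c := by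
      have h4 : (Scheme.ΓSpecIso (.of k)).inv ≫ (𝟙 (Spec (.of k)) : Spec (.of k) ⟶ _).appLE ⊤ ⊤
          le_top ≫ (Scheme.ΓSpecIso (.of k)).hom = 𝟙 _ := by
        simp [Scheme.Hom.appLE]
      exact congrArg (fun f ↦ f.hom c) h4
    rw [h3] at h2
    exact h2
  refine (congrArg (awayDehomogenize i s hs) h1).trans ?_
  refine (awayDehomogenize_of_val_eq_mk hs (a := C c) (j := 0) ?_).trans ?_
  · rfl
  · exact (dehomogenize i).commutes c

/-- The coordinate map on `D₊(s)` does not depend on the way in which `s` is presented. -/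
lemma chartCoord_congr {s' : MvPolynomial (Fin (n + 1)) k} {d' : ℕ}
    (hs' : dehomogenize i s' = 1) (hd' : 0 < d')
    (hsd' : s' ∈ homogeneousSubmodule (Fin (n + 1)) k d')
    (hV' : V = Proj.basicOpen (homogeneousSubmodule (Fin (n + 1)) k) s')
    (h : s = s') (h' : d = d') : chartCoord i hs hd hsd V hV = chartCoord i hs' hd' hsd' V hV' := by
  subst h h'
  rfl

/-- On the charts `D₊(s)`, pulling back functions along the morphism
`[x₀ : … : xₙ] ↦ [x₀ ^ m : t₁ x₁ ^ m : … : tₙ xₙ ^ m]` is the substitution `coordHom`. -/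
lemma chartSections_coordMap_appLE (t : Fin n → kˣ) {m : ℕ} (hm : 0 < m)
    {W : (ProjSpace n k).Opens}
    (hW : W = Proj.basicOpen (homogeneousSubmodule (Fin (n + 1)) k)
      (coordHom (RingHom.id k) t m s))
    (hVW : W ≤ coordMap (RingHom.id k) t m hm ⁻¹ᵁ V) (y : Γ(ProjSpace n k, V)) :
    chartSections (Proj.awayι _ (coordHom (RingHom.id k) t m s)
        ((coordHom_isScaling (RingHom.id k) t hm).map_mem _ _ hsd) (Nat.mul_pos hm hd)) W
        (top_le_awayι_preimage _ _ hW) ((coordMap (RingHom.id k) t m hm).appLE V W hVW y) =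
      awayScale (coordHom_isScaling (RingHom.id k) t hm) s
        (chartSections (Proj.awayι _ s hsd hd) V (top_le_awayι_preimage hsd hd hV) y) :=
  chartSections_appLE
    (φ := CommRingCat.ofHom (awayScale (coordHom_isScaling (RingHom.id k) t hm) s))
    (awayι_projScale (coordHom_isScaling (RingHom.id k) t hm) hd s hsd) _ _ hVW y

end

/-! ### The toric Frobenius morphism on the standard charts -/

section Frobenius

variable {m : ℕ} (hm : 0 < m) (i : Fin (n + 1))

lemma coordHom_X (t : Fin n → kˣ) (m : ℕ) (l : Fin (n + 1)) :
    coordHom (RingHom.id k) t m (X l) = C ((Fin.cons 1 t : Fin (n + 1) → kˣ) l : k) * X l ^ m := by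
  simp [coordHom]

lemma coordHom_one_X (m : ℕ) (l : Fin (n + 1)) :
    coordHom (RingHom.id k) (1 : Fin n → kˣ) m (X l) = X l ^ m := by
  rw [coordHom_X]
  refine Fin.cases ?_ (fun l ↦ ?_) l <;> simp

/-- The preimage of the chart `xᵢ ≠ 0` under the toric Frobenius morphism. -/
noncomputable abbrev frobeniusChart : (ProjSpace n k).Opens :=
  toricFrobenius n k m hm ⁻¹ᵁ standardChart i

lemma frobeniusChart_eq : frobeniusChart hm i =
    Proj.basicOpen (homogeneousSubmodule (Fin (n + 1)) k)
      (coordHom (RingHom.id k) (1 : Fin n → kˣ) m (X i)) :=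
  projScale_preimage_basicOpen _ one_pos (isHomogeneous_X k i)

lemma isHomogeneous_coordHom_X {m : ℕ} (hm : 0 < m) (i : Fin (n + 1)) :
    coordHom (RingHom.id k) (1 : Fin n → kˣ) m (X i) ∈
      homogeneousSubmodule (Fin (n + 1)) k (m * 1) :=
  (coordHom_isScaling (RingHom.id k) 1 hm).map_mem _ _ (isHomogeneous_X k i)

lemma isAffineOpen_frobeniusChart : IsAffineOpen (frobeniusChart hm i : (ProjSpace n k).Opens) := by
  rw [frobeniusChart_eq]
  exact Proj.isAffineOpen_basicOpen _ _ (isHomogeneous_coordHom_X hm i) (Nat.mul_pos hm one_pos)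

lemma dehomogenize_coordHom_X :
    dehomogenize i (coordHom (RingHom.id k) (1 : Fin n → kˣ) m (X i)) = 1 := by
  rw [coordHom_one_X, map_pow, dehomogenize_X_self, one_pow]

/-- The coordinates on `frobeniusChart hm i`. This is the chart `xᵢ ≠ 0` again, but presented as
`D₊(xᵢ ^ m)`. -/
noncomputable def frobeniusChartCoord :
    Γ(ProjSpace n k, frobeniusChart hm i) →+* MvPolynomial {l // l ≠ i} k :=
  chartCoord i (dehomogenize_coordHom_X i) (Nat.mul_pos hm one_pos) (isHomogeneous_coordHom_X hm i)
    _ (frobeniusChart_eq hm i)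

lemma bijective_frobeniusChartCoord [Infinite k] :
    Function.Bijective (frobeniusChartCoord (n := n) (k := k) hm i) :=
  bijective_chartCoord ..

lemma frobeniusChartCoord_const (c : k) :
    frobeniusChartCoord (n := n) hm i (ProjSpace.const c _) = C c :=
  chartCoord_const ..

/-- The coordinates on the standard chart `xᵢ ≠ 0`. -/
noncomputable def standardChartCoord :
    Γ(ProjSpace n k, standardChart i) →+* MvPolynomial {l // l ≠ i} k :=
  chartCoord i (dehomogenize_X_self i) one_pos (isHomogeneous_X k i) _ rfl

lemma bijective_standardChartCoord [Infinite k] :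
    Function.Bijective (standardChartCoord (n := n) (k := k) i) :=
  bijective_chartCoord ..

lemma standardChartCoord_const (c : k) :
    standardChartCoord (n := n) i (ProjSpace.const c _) = C c :=
  chartCoord_const ..

lemma dehomogenize_coordHom (p : MvPolynomial (Fin (n + 1)) k) :
    dehomogenize i (coordHom (RingHom.id k) (1 : Fin n → kˣ) m p) =
      expand m (dehomogenize i p) := by
  induction p using MvPolynomial.induction_on with
  | C c => simp [coordHom]
  | add p q hp hq => simp only [map_add, hp, hq]
  | mul_X p l hp =>
    rw [map_mul, map_mul, map_mul, map_mul, hp, coordHom_one_X, map_pow]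
    congr 1
    by_cases h : l = i
    · subst h
      simp
    · rw [dehomogenize_X_of_ne i h, expand_X]

/-- On the charts, the comorphism of the toric Frobenius morphism replaces all variables by their
`m`-th powers. -/
lemma frobeniusChartCoord_app (y : Γ(ProjSpace n k, standardChart i)) :
    frobeniusChartCoord hm i ((toricFrobenius n k m hm).app (standardChart i) y) =
      expand m (standardChartCoord i y) := by
  have h := chartSections_coordMap_appLE one_pos (isHomogeneous_X k i) (V := standardChart i) rfl
    1 hm (frobeniusChart_eq hm i) le_rfl y
  obtain ⟨j, a, ha, hz⟩ := Away.mk_surjective _ (isHomogeneous_X k i)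
    (chartSections (Proj.awayι _ (X i) (isHomogeneous_X k i) one_pos) (standardChart i)
      (top_le_awayι_preimage (isHomogeneous_X k i) one_pos rfl) y)
  have hv := (congrArg val hz.symm).trans (Away.val_mk _ j (isHomogeneous_X k i) a ha)
  have h1 := awayDehomogenize_awayScale (coordHom_isScaling (RingHom.id k) (1 : Fin n → kˣ) hm)
    (dehomogenize_coordHom_X i) hv
  have h2 := awayDehomogenize_of_val_eq_mk (dehomogenize_X_self i) hv
  rw [Scheme.Hom.app_eq_appLE]
  refine (congrArg (awayDehomogenize i _ (dehomogenize_coordHom_X i)) h).trans ?_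
  refine (h1.trans (dehomogenize_coordHom i a)).trans (congrArg (expand m) h2.symm)

lemma toricFrobenius_app_const [Infinite k] (c : k) :
    (toricFrobenius n k m hm).app (standardChart i) (ProjSpace.const c _) =
      ProjSpace.const c _ := by
  refine (bijective_frobeniusChartCoord hm i).1 ?_
  rw [frobeniusChartCoord_app, standardChartCoord_const, expand_C]
  exact (frobeniusChartCoord_const hm i c).symm

/-- The toric Frobenius morphism is finite and free of rank `m ^ n` over the standard charts. -/
lemma free_toricFrobenius_app [Infinite k] :
    letI := ((toricFrobenius n k m hm).app (standardChart i)).hom.toAlgebra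
    Module.Free Γ(ProjSpace n k, standardChart i) Γ(ProjSpace n k, frobeniusChart hm i) ∧
    Module.Finite Γ(ProjSpace n k, standardChart i) Γ(ProjSpace n k, frobeniusChart hm i) ∧
    Module.finrank Γ(ProjSpace n k, standardChart i) Γ(ProjSpace n k, frobeniusChart hm i) =
      m ^ n := by
  let := ((toricFrobenius n k m hm).app (standardChart i)).hom.toAlgebra
  have := (standardChartCoord (n := n) (k := k) i).domain_nontrivial
  have h := free_of_expand (R := Γ(ProjSpace n k, standardChart i))
    (S := Γ(ProjSpace n k, frobeniusChart hm i)) hm (standardChartCoord i)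
    (bijective_standardChartCoord i) (frobeniusChartCoord hm i) (bijective_frobeniusChartCoord hm i)
    (frobeniusChartCoord_app hm i)
  simpa using h

/-- Every character of `μₘⁿ` is a monomial in the coordinates. -/
lemma exists_eq_prod_pow (hm : 0 < m) (ψ : MuPow n k m →* kˣ) :
    ∃ c : Fin n → ℕ, ∀ g : MuPow n k m, (ψ g : k) = ∏ l, ((g.toPoint l : kˣ) : k) ^ c l := by
  have : NeZero m := ⟨hm.ne'⟩
  have key (l : Fin n) : ∃ c : ℕ, ∀ ζ : rootsOfUnity m k,
      ψ (Pi.mulSingle l ζ) = (ζ : kˣ) ^ c := by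
    obtain ⟨ξ, hξ⟩ := IsCyclic.exists_monoid_generator (α := rootsOfUnity m k)
    have h1 : ψ (Pi.mulSingle l ξ) ∈ rootsOfUnity m k := by
      have h2 : ξ ^ m = 1 := Subtype.ext (by simpa using (mem_rootsOfUnity m _).mp ξ.2)
      rw [mem_rootsOfUnity, ← map_pow, ← Pi.mulSingle_pow, h2, Pi.mulSingle_one, map_one]
    obtain ⟨c, hc⟩ := hξ ⟨_, h1⟩
    refine ⟨c, fun ζ ↦ ?_⟩
    obtain ⟨a, rfl⟩ := hξ ζ
    have hc' : (ξ : kˣ) ^ c = ψ (Pi.mulSingle l ξ) := congrArg Subtype.val hc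
    change ψ (Pi.mulSingle l (ξ ^ a)) = ((ξ ^ a : rootsOfUnity m k) : kˣ) ^ c
    rw [Pi.mulSingle_pow, map_pow, ← hc', Subgroup.coe_pow, ← pow_mul, ← pow_mul, mul_comm]
  choose c hc using key
  refine ⟨c, fun g ↦ ?_⟩
  have h1 : ψ g = ∏ l, (g l : kˣ) ^ c l := by
    conv_lhs => rw [← Finset.univ_prod_mulSingle g, map_prod]
    exact Finset.prod_congr rfl fun l _ ↦ hc l _
  rw [h1]
  simp [MuPow.toPoint]

lemma toPoint_pow (g : MuPow n k m) (l : Fin (n + 1)) :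
    ((Fin.cons 1 g.toPoint : Fin (n + 1) → kˣ) l : k) ^ m = 1 := by
  refine Fin.cases ?_ (fun l ↦ ?_) l
  · simp
  · exact (mem_rootsOfUnity' m _).mp (g l).2

lemma frobeniusChart_le_preimage_translate (g : MuPow n k m) :
    frobeniusChart hm i ≤ translate g.toPoint ⁻¹ᵁ frobeniusChart hm i := by
  rw [← Scheme.Hom.comp_preimage, translate_toricFrobenius]

/-- For every character `ψ` of `μₘⁿ` there is a regular function `y ≠ 0` on the preimage of the
chart `xᵢ ≠ 0` with `y (g x) = ψ g * y x`: a suitable monomial, of degree divisible by `m`, divided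
by a power of `xᵢ ^ m`. -/
lemma exists_eigenfunction [Infinite k] (ψ : MuPow n k m →* kˣ) :
    ∃ y : Γ(ProjSpace n k, frobeniusChart hm i), y ≠ 0 ∧ ∀ g : MuPow n k m,
      (translate g.toPoint).appLE _ _ (frobeniusChart_le_preimage_translate hm i g) y =
        ProjSpace.const (ψ g : k) _ * y := by
  obtain ⟨c, hc⟩ := exists_eq_prod_pow hm ψ
  -- The exponent of `x₀` makes the degree a multiple of `m`; it does not affect the character.
  let b : Fin (n + 1) → ℕ := Fin.cons ((m - 1) * ∑ l, c l) c
  have hb : ∑ l, b l = (∑ l, c l) * (m * 1) := by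
    obtain ⟨m, rfl⟩ := Nat.exists_eq_succ_of_ne_zero hm.ne'
    simp only [b, Fin.sum_univ_succ, Fin.cons_zero, Fin.cons_succ, Nat.succ_sub_one]
    rw [Nat.succ_eq_add_one]
    ring
  let a : MvPolynomial (Fin (n + 1)) k := ∏ l, X l ^ b l
  have ha : a ∈ homogeneousSubmodule (Fin (n + 1)) k ((∑ l, c l) • (m * 1)) := by
    rw [smul_eq_mul, ← hb]
    exact IsHomogeneous.prod _ _ _ fun l _ ↦ isHomogeneous_X_pow l (b l)
  let s := coordHom (RingHom.id k) (1 : Fin n → kˣ) m (X i)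
  have hs := isHomogeneous_coordHom_X (k := k) hm i
  have hd := Nat.mul_pos hm one_pos
  obtain ⟨y, hy⟩ := (bijective_chartSections_awayι hd hs (frobeniusChart_eq hm i)).2
    (Away.mk _ hs (∑ l, c l) a ha)
  have hv := (congrArg val hy).trans (Away.val_mk _ (∑ l, c l) hs a ha)
  have hya : frobeniusChartCoord hm i y = dehomogenize i a :=
    awayDehomogenize_of_val_eq_mk (dehomogenize_coordHom_X i) hv
  refine ⟨y, fun h ↦ dehomogenize_ne_zero_of_prod_X (k := k) i b ?_, fun g ↦ ?_⟩
  · rw [h, map_zero] at hya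
    exact hya.symm
  · have hgs : coordHom (RingHom.id k) g.toPoint 1 s = s := by
      simp only [s]
      rw [coordHom_one_X, map_pow, coordHom_X, pow_one, mul_pow, ← map_pow, toPoint_pow, map_one,
        one_mul]
    have hga : coordHom (RingHom.id k) g.toPoint 1 a = C (ψ g : k) * a := by
      simp only [a, map_prod, map_pow, coordHom_X, pow_one, mul_pow, Finset.prod_mul_distrib]
      congr 1
      rw [hc, Fin.prod_univ_succ]
      simp [b]
    have hW : frobeniusChart hm i = Proj.basicOpen (homogeneousSubmodule (Fin (n + 1)) k)
        (coordHom (RingHom.id k) g.toPoint 1 s) := by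
      rw [hgs]
      exact frobeniusChart_eq hm i
    have hgs1 : dehomogenize i (coordHom (RingHom.id k) g.toPoint 1 s) = 1 := by
      rw [hgs]
      exact dehomogenize_coordHom_X i
    have h1 := chartSections_coordMap_appLE hd hs (frobeniusChart_eq hm i) g.toPoint one_pos hW
      (frobeniusChart_le_preimage_translate hm i g) y
    have h2 := awayDehomogenize_awayScale (coordHom_isScaling (RingHom.id k) g.toPoint one_pos)
      hgs1 hv
    have h3 : frobeniusChartCoord hm i = chartCoord i hgs1 _
        ((coordHom_isScaling (RingHom.id k) g.toPoint one_pos).map_mem _ _ hs) _ hW :=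
      chartCoord_congr _ _ _ _ _ (Nat.mul_pos one_pos hd) _ _ hgs.symm (one_mul _).symm
    refine (bijective_frobeniusChartCoord hm i).1 ?_
    rw [map_mul, frobeniusChartCoord_const, hya]
    refine (DFunLike.congr_fun h3 _).trans ?_
    refine (congrArg (awayDehomogenize i _ hgs1) h1).trans (h2.trans ?_)
    rw [hga, map_mul]
    congr 1
    exact (dehomogenize i).commutes _

end Frobenius

end ProjSpaceCharts

end ToricFrobenius

namespace ToricFrobenius

/-! ### Isotypic projectors of a finite commutative group -/

section Characters

variable {G k A : Type*} [CommGroup G] [Fintype G] [Field k] [Ring A] [Algebra k A] (a : G →* A)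

/-- The projector `|G|⁻¹ ∑ χ(g)⁻¹ g` onto the `χ`-isotypic part of a representation. -/
noncomputable def isotypicProjector (χ : G →* kˣ) : A :=
  (Fintype.card G : k)⁻¹ • ∑ g, ((χ g⁻¹ : kˣ) : k) • a g

lemma mul_isotypicProjector (χ : G →* kˣ) (g : G) :
    a g * isotypicProjector a χ = (χ g : k) • isotypicProjector a χ := by
  rw [isotypicProjector, mul_smul_comm, smul_comm (χ g : k), Finset.mul_sum]
  refine congrArg _ ?_
  rw [Finset.smul_sum]
  refine Fintype.sum_equiv (Equiv.mulLeft g) _ _ fun h ↦ ?_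
  rw [mul_smul_comm, ← map_mul, Equiv.coe_mulLeft, smul_smul, ← Units.val_mul, ← map_mul]
  congr 3
  simp

/-- The vectors fixed by the `χ`-isotypic projector are those on which `G` acts through `χ`. -/
lemma isotypicProjector_smul_eq_iff {N : Type*} [AddCommGroup N] [Module A N]
    (hG : (Fintype.card G : k) ≠ 0) (χ : G →* kˣ) (s : N) :
    isotypicProjector a χ • s = s ↔ ∀ g, a g • s = algebraMap k A (χ g) • s := by
  constructor
  · intro h g
    rw [← h, smul_smul, mul_isotypicProjector, Algebra.smul_def, mul_smul]
  · intro h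
    have h1 (g : G) : (((χ g⁻¹ : kˣ) : k) • a g) • s = s := by
      rw [Algebra.smul_def, mul_smul, h, smul_smul, ← map_mul, ← Units.val_mul, ← map_mul]
      simp
    rw [isotypicProjector, Algebra.smul_def, mul_smul, Finset.sum_smul, Finset.sum_congr rfl
      fun g _ ↦ h1 g, Finset.sum_const, Finset.card_univ, ← Nat.cast_smul_eq_nsmul A, smul_smul,
      ← map_natCast (algebraMap k A), ← map_mul, inv_mul_cancel₀ hG, map_one, one_smul]

lemma isotypicProjector_mul_self (hG : (Fintype.card G : k) ≠ 0) (χ : G →* kˣ) :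
    isotypicProjector a χ * isotypicProjector a χ = isotypicProjector a χ := by
  refine (isotypicProjector_smul_eq_iff a hG χ (isotypicProjector a χ)).mpr fun g ↦ ?_
  rw [smul_eq_mul, mul_isotypicProjector, smul_eq_mul, Algebra.smul_def]

lemma isotypicProjector_mul_of_ne {χ ψ : G →* kˣ} (h : χ ≠ ψ) :
    isotypicProjector a χ * isotypicProjector a ψ = 0 := by
  have h1 : ∑ g, ((χ g⁻¹ : kˣ) : k) * (ψ g : k) = 0 := by
    have h2 := sum_hom_units_eq_zero ((Units.coeHom k).comp (χ⁻¹ * ψ)) fun h0 ↦ h ?_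
    · simpa using h2
    · ext g
      have h3 := DFunLike.congr_fun h0 g
      have h4 : (χ g)⁻¹ * ψ g = 1 := Units.ext (by simpa using h3)
      rw [inv_mul_eq_one.mp h4]
  rw [isotypicProjector, smul_mul_assoc, Finset.sum_mul]
  simp only [smul_mul_assoc, mul_isotypicProjector, smul_smul]
  rw [← Finset.sum_smul, h1, zero_smul, smul_zero]

lemma sum_isotypicProjector [Fintype (G →* kˣ)] [HasEnoughRootsOfUnity k (Monoid.exponent G)]
    (hG : (Fintype.card G : k) ≠ 0) : ∑ χ : G →* kˣ, isotypicProjector a χ = 1 := by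
  classical
  have hcard : (Fintype.card (G →* kˣ) : k) = Fintype.card G := by
    rw [← Nat.card_eq_fintype_card, ← Nat.card_eq_fintype_card,
      CommGroup.card_monoidHom_of_hasEnoughRootsOfUnity]
  have h1 (g : G) : ∑ χ : G →* kˣ, ((χ g⁻¹ : kˣ) : k) =
      if g = 1 then (Fintype.card G : k) else 0 := by
    split_ifs with hg
    · simp [hg, hcard]
    · obtain ⟨χ, hχ⟩ := CommGroup.exists_apply_ne_one_of_hasEnoughRootsOfUnity G k
        (inv_ne_one.mpr hg)
      refine sum_hom_units_eq_zero ((Units.coeHom k).comp (MonoidHom.eval g⁻¹)) fun h0 ↦ hχ ?_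
      exact Units.ext (by simpa using DFunLike.congr_fun h0 χ)
  simp only [isotypicProjector]
  rw [← Finset.smul_sum, Finset.sum_comm]
  simp only [← Finset.sum_smul, h1, ite_smul, zero_smul, Finset.sum_ite_eq', Finset.mem_univ,
    if_true, map_one, smul_smul, inv_mul_cancel₀ hG, one_smul]

end Characters

section Split

variable {C : Type*} [Category* C] [Preadditive C] [IsIdempotentComplete C]

/-- Splitting a complete system of orthogonal idempotents: an object with such a system of
endomorphisms is the coproduct of their images. -/
lemma exists_isColimit_cofan_of_orthogonal_idempotents {I : Type*} [Finite I] {M : C}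
    (e : I → (M ⟶ M)) (he : ∀ i, e i ≫ e i = e i) (hne : ∀ i j, i ≠ j → e i ≫ e j = 0)
    (hsum : letI := Fintype.ofFinite I; ∑ i, e i = 𝟙 M) :
    ∃ (N : I → C) (ι : ∀ i, N i ⟶ M) (π : ∀ i, M ⟶ N i), (∀ i, ι i ≫ π i = 𝟙 _) ∧
      (∀ i j, i ≠ j → ι i ≫ π j = 0) ∧ (∀ i, π i ≫ ι i = e i) ∧
      Nonempty (Limits.IsColimit (Limits.Cofan.mk M ι)) := by
  classical
  let := Fintype.ofFinite I
  choose N ι π h₁ h₂ using fun i ↦ IsIdempotentComplete.idempotents_split M (e i) (he i)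
  have h₃ (i j : I) (hij : i ≠ j) : ι i ≫ π j = 0 := by
    have : ι i ≫ π j = ι i ≫ (π i ≫ ι i) ≫ (π j ≫ ι j) ≫ π j := by
      simp only [Category.assoc, h₁, reassoc_of% h₁ i, Category.comp_id]
    rw [this, h₂, h₂, reassoc_of% hne i j hij, Limits.zero_comp, Limits.comp_zero]
  refine ⟨N, ι, π, h₁, h₃, h₂, ⟨Limits.Cofan.IsColimit.mk _ (fun s ↦ ∑ i, π i ≫ s.inj i) ?_ ?_⟩⟩
  · intro s j
    rw [Limits.Cofan.inj]
    refine (Preadditive.comp_sum _ _ _).trans ?_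
    rw [Finset.sum_eq_single j]
    · exact (Category.assoc _ _ _).symm.trans ((congrArg (· ≫ _) (h₁ j)).trans (Category.id_comp _))
    · intro i _ hi
      exact (Category.assoc _ _ _).symm.trans
        ((congrArg (· ≫ _) (h₃ j i hi.symm)).trans Limits.zero_comp)
    · simp
  · intro s f hf
    have h4 : f = (∑ i, e i) ≫ f := by
      rw [hsum]
      exact (Category.id_comp f).symm
    rw [h4, Preadditive.sum_comp]
    refine Finset.sum_congr rfl fun i _ ↦ ?_
    rw [← h₂, Category.assoc, ← hf i]
    rfl

end Split

end ToricFrobenius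

namespace ToricFrobenius

/-! ### Group actions on `𝒪`-modules and isotypic components -/

section Isotypic

open Scheme.Modules

variable {X : Scheme.{u}} (M : X.Modules)

/-- The restriction of global functions to an open subset. -/
noncomputable def resTop (U : X.Opens) : Γ(X, ⊤) →+* Γ(X, U) :=
  (X.presheaf.map (homOfLE le_top).op).hom

lemma map_resTop {U V : X.Opens} (i : U ⟶ V) (c : Γ(X, ⊤)) :
    X.presheaf.map i.op (resTop V c) = resTop U c := by
  change (X.presheaf.map (homOfLE le_top).op ≫ X.presheaf.map i.op) c = _
  rw [← Functor.map_comp]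
  rfl

/-- Multiplication by a global function, as an endomorphism of an `𝒪`-module. -/
noncomputable def globalSmul (c : Γ(X, ⊤)) : M ⟶ M where
  val := PresheafOfModules.homMk
    { app := fun V ↦ M.smul (U := V.unop) (resTop V.unop c)
      naturality := fun V W i ↦ by
        refine ConcreteCategory.hom_ext _ _ fun s ↦ ?_
        refine ((Scheme.Modules.map_smul M i.unop (resTop V.unop c) s).trans ?_).symm
        exact congrArg (· • _) (map_resTop i.unop c) }
    fun V r s ↦ smul_comm (M := Γ(X, V.unop)) (N := Γ(X, V.unop)) (α := Γ(M, V.unop))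
      (resTop V.unop c) r s

lemma globalSmul_app (c : Γ(X, ⊤)) (U : X.Opens) (s : Γ(M, U)) :
    (globalSmul M c).app U s = resTop U c • s := rfl

lemma globalSmul_comm {M N : X.Modules} (f : M ⟶ N) (c : Γ(X, ⊤)) :
    globalSmul M c ≫ f = f ≫ globalSmul N c :=
  Scheme.Modules.hom_ext _ _ fun U ↦ ConcreteCategory.hom_ext _ _ fun s ↦
    Hom.app_smul f (resTop U c) s

/-- The global functions act on an `𝒪`-module by endomorphisms. -/
noncomputable def globalSmulHom : Γ(X, ⊤) →+* End M where
  toFun := globalSmul M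
  map_one' := Scheme.Modules.hom_ext _ _ fun U ↦ ConcreteCategory.hom_ext _ _ fun s ↦ by
    rw [globalSmul_app, map_one, one_smul]
    rfl
  map_zero' := Scheme.Modules.hom_ext _ _ fun U ↦ ConcreteCategory.hom_ext _ _ fun s ↦ by
    rw [globalSmul_app, map_zero, zero_smul]
    rfl
  map_add' c d := Scheme.Modules.hom_ext _ _ fun U ↦ ConcreteCategory.hom_ext _ _ fun s ↦ by
    rw [globalSmul_app, map_add, add_smul]
    rfl
  map_mul' c d := Scheme.Modules.hom_ext _ _ fun U ↦ ConcreteCategory.hom_ext _ _ fun s ↦ by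
    rw [globalSmul_app, map_mul, mul_smul]
    rfl

/-- The sections of `M` form a module over the endomorphism ring of `M`. -/
noncomputable abbrev endModule (U : X.Opens) : Module (End M) Γ(M, U) where
  smul f s := f.app U s
  one_smul _ := rfl
  mul_smul _ _ _ := rfl
  smul_zero f := map_zero (f.app U).hom
  smul_add f := map_add (f.app U).hom
  add_smul _ _ _ := rfl
  zero_smul _ := rfl

/-- If a finite commutative group `G` acts on an `𝒪`-module `M` over a scheme with a map to
`Spec k`, where `k` contains enough roots of unity, then `M` is the direct sum of its isotypic
components. -/
lemma exists_isotypic_decomposition {G k : Type*} [CommGroup G] [Finite G] [Field k]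
    [HasEnoughRootsOfUnity k (Monoid.exponent G)] (hG : (Nat.card G : k) ≠ 0)
    (κ : k →+* Γ(X, ⊤)) (a : G → (M ⟶ M)) (ha₁ : a 1 = 𝟙 M) (ha : ∀ g h, a (g * h) = a g ≫ a h) :
    ∃ (N : (G →* kˣ) → X.Modules) (ι : ∀ χ, N χ ⟶ M) (π : ∀ χ, M ⟶ N χ),
      (∀ χ, ι χ ≫ π χ = 𝟙 _) ∧ (∀ χ ψ, χ ≠ ψ → ι χ ≫ π ψ = 0) ∧
      (∀ χ (U : X.Opens), Set.range ((ι χ).app U) =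
        {s | ∀ g, (a g).app U s = resTop U (κ (χ g : k)) • s}) ∧
      (letI := Fintype.ofFinite (G →* kˣ); ∑ χ, π χ ≫ ι χ = 𝟙 M) ∧
      Nonempty (Limits.IsColimit (Limits.Cofan.mk M ι)) := by
  classical
  let := Fintype.ofFinite G
  let := Fintype.ofFinite (G →* kˣ)
  rw [Nat.card_eq_fintype_card] at hG
  let : Algebra k (End M) := ((globalSmulHom M).comp κ).toAlgebra' fun c f ↦
    (globalSmul_comm f (κ c)).symm
  let a' : G →* End M :=
    { toFun := a
      map_one' := ha₁
      map_mul' := fun g h ↦ by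
        rw [mul_comm, ha]
        rfl }
  obtain ⟨N, ι, π, h₁, h₀, h₂, h₃⟩ := exists_isColimit_cofan_of_orthogonal_idempotents
    (fun χ : G →* kˣ ↦ (isotypicProjector a' χ : End M))
    (fun χ ↦ isotypicProjector_mul_self a' hG χ)
    (fun χ ψ h ↦ isotypicProjector_mul_of_ne a' h.symm)
    (sum_isotypicProjector a' hG)
  refine ⟨N, ι, π, h₁, h₀, fun χ U ↦ Set.ext fun s ↦ ?_, ?_, h₃⟩
  · let := endModule M U
    have h₄ := isotypicProjector_smul_eq_iff a' hG χ s
    refine Iff.trans ?_ h₄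
    have h₅ : (isotypicProjector a' χ : End M) • s = (ι χ).app U ((π χ).app U s) :=
      ConcreteCategory.congr_hom (congrArg (fun f ↦ f.app U) (h₂ χ).symm) s
    rw [h₅]
    refine ⟨?_, fun h ↦ ⟨_, h⟩⟩
    rintro ⟨t, rfl⟩
    exact congrArg ((ι χ).app U)
      (ConcreteCategory.congr_hom (congrArg (fun f ↦ f.app U) (h₁ χ)) t)
  · rw [Finset.sum_congr rfl fun χ _ ↦ h₂ χ]
    exact sum_isotypicProjector a' hG

end Isotypic

end ToricFrobenius

namespace ToricFrobenius

/-! ### Ranks of the isotypic components -/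

section RankAlgebra

open Module

/-- Over a domain the rank of a finite flat module is its rank at the generic point. -/
lemma rankAtStalk_bot {R : Type*} [CommRing R] [IsDomain R] (N : Type*) [AddCommGroup N]
    [Module R N] [Module.Finite R N] [Flat R N] :
    rankAtStalk (R := R) N ⟨⊥, Ideal.isPrime_bot⟩ = finrank R N := by
  rw [← Ideal.finrank_fiber_eq_finrank (⊥ : Ideal R), Ideal.finrank_fiber_eq_rankAtStalk]

lemma finrank_pi_of_projective {R I : Type*} [Fintype I] [CommRing R] [IsDomain R] (Q : I → Type*)
    [∀ i, AddCommGroup (Q i)] [∀ i, Module R (Q i)] [∀ i, Module.Finite R (Q i)]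
    [∀ i, Projective R (Q i)] : finrank R (∀ i, Q i) = ∑ i, finrank R (Q i) := by
  have := Projective.of_equiv (DFinsupp.linearEquivFunOnFintype (R := R) (M := Q))
  rw [← rankAtStalk_bot (∀ i, Q i)]
  simp only [← rankAtStalk_bot]
  rw [rankAtStalk_pi, finsum_eq_sum_of_fintype]

lemma projective_of_free_of_projective (R S P : Type*) [CommRing R] [CommRing S] [Algebra R S]
    [AddCommGroup P] [Module R P] [Module S P] [IsScalarTower R S P] [Module.Free R S]
    [Projective S P] : Projective R P := by
  obtain ⟨ι, hι⟩ := Projective.out (R := S) (P := P)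
  exact .of_split (M := P →₀ S) (ι.restrictScalars R)
    ((Finsupp.linearCombination S id).restrictScalars R) (LinearMap.ext hι)

/-- Let `P` be a projective module over a finite free extension `S` of `R`, which as an `R`-module
is the direct sum of `[S : R]` submodules any two of which embed into each other. Then each of them
has the same rank over `R` as `P` has over `S`. -/
lemma finrank_eq_of_isInternal {R S P I : Type*} [CommRing R] [CommRing S] [IsDomain R] [IsDomain S]
    [Algebra R S] [AddCommGroup P] [Module R P] [Module S P] [IsScalarTower R S P]
    [Module.Finite R S] [Module.Free R S] [Module.Finite S P] [Projective S P] [Fintype I]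
    (hI : Fintype.card I = finrank R S)
    (Q : I → Type*) [∀ i, AddCommGroup (Q i)] [∀ i, Module R (Q i)]
    (ι : ∀ i, Q i →ₗ[R] P) (π : ∀ i, P →ₗ[R] Q i) (h₁ : ∀ i x, π i (ι i x) = x)
    (h₀ : ∀ i j, i ≠ j → ∀ x, π j (ι i x) = 0) (h : ∀ x, ∑ i, ι i (π i x) = x)
    (hinj : ∀ i j, ∃ f : Q i →ₗ[R] Q j, Function.Injective f) (i : I) :
    Module.Finite R (Q i) ∧ Projective R (Q i) ∧ finrank R (Q i) = finrank S P := by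
  classical
  have hfin : Module.Finite R P := .trans S P
  have hproj : Projective R P := projective_of_free_of_projective R S P
  have hfin' (i) : Module.Finite R (Q i) :=
    .of_surjective (π i) fun x ↦ ⟨ι i x, h₁ i x⟩
  have hproj' (i) : Projective R (Q i) :=
    .of_split (ι i) (π i) (LinearMap.ext (h₁ i))
  refine ⟨hfin' i, hproj' i, ?_⟩
  have heq (j) : finrank R (Q j) = finrank R (Q i) := by
    obtain ⟨f, hf⟩ := hinj j i
    obtain ⟨f', hf'⟩ := hinj i j
    exact (LinearMap.finrank_le_finrank_of_injective hf).antisymm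
      (LinearMap.finrank_le_finrank_of_injective hf')
  let e : P ≃ₗ[R] (∀ i, Q i) := LinearEquiv.ofBijective (LinearMap.pi π)
    ⟨fun x y hxy ↦ by
      rw [← h x, ← h y]
      exact Finset.sum_congr rfl fun j _ ↦ congrArg (ι j) (congrFun hxy j),
    fun y ↦ ⟨∑ j, ι j (y j), funext fun j ↦ by
      rw [LinearMap.pi_apply, map_sum, Finset.sum_eq_single j]
      · exact h₁ j _
      · exact fun l _ hl ↦ h₀ l j hl _
      · simp⟩⟩
  have h₂ := finrank_mul_finrank_of_projective R S P
  rw [e.finrank_eq, finrank_pi_of_projective, Finset.sum_congr rfl fun j _ ↦ heq j,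
    Finset.sum_const, Finset.card_univ, smul_eq_mul, hI] at h₂
  exact (Nat.eq_of_mul_eq_mul_left (finrank_pos) h₂).symm

end RankAlgebra

section Semilinear

open Scheme.Modules

/-- The sections of `F_* E` over `U` form a module over the functions on `F⁻¹ U`. -/
noncomputable abbrev pushforwardModule {P Q : Scheme.{u}} (F : P ⟶ Q) (E : P.Modules)
    (U : Q.Opens) : Module Γ(P, F ⁻¹ᵁ U) Γ((pushforward F).obj E, U) :=
  (inferInstance : Module Γ(P, F ⁻¹ᵁ U) Γ(E, F ⁻¹ᵁ U))

attribute [local instance] pushforwardModule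

/-- An endomorphism of `F_* E` induced by an automorphism `τ` over `F` is `τ`-semilinear with
respect to the functions upstairs. -/
lemma pushforwardEnd_smul {P Q : Scheme.{u}} {τ : P ⟶ P} {F : P ⟶ Q} (h : τ ≫ F = F)
    {E : P.Modules} (a : E ⟶ (pushforward τ).obj E) (U : Q.Opens)
    (hU : F ⁻¹ᵁ U ≤ τ ⁻¹ᵁ F ⁻¹ᵁ U) (y : Γ(P, F ⁻¹ᵁ U)) (s : Γ((pushforward F).obj E, U)) :
    (pushforwardEnd h a).app U (y • s) = τ.appLE _ _ hU y • (pushforwardEnd h a).app U s := by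
  refine (pushforwardEnd_app h a U (y • s)).trans ?_
  refine (congrArg (E.presheaf.map (homOfLE hU).op) (Hom.app_smul a y _)).trans ?_
  exact Scheme.Modules.map_smul E (homOfLE hU) (τ.app _ y) (a.app (F ⁻¹ᵁ U) _)

end Semilinear

end ToricFrobenius

namespace ToricFrobenius

/-! ### The isotypic components of the toric Frobenius pushforward -/

section Summands

open Scheme.Modules

attribute [local instance] pushforwardModule

/-- The map on sections over `U` induced by a morphism of `𝒪`-modules, as a linear map. -/
noncomputable def appLinear {X : Scheme.{u}} {M N : X.Modules} (φ : M ⟶ N) (U : X.Opens) :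
    Γ(M, U) →ₗ[Γ(X, U)] Γ(N, U) where
  toFun := φ.app U
  map_add' := map_add (φ.app U).hom
  map_smul' := Hom.app_smul φ

/-- Over an affine open subset `U` over which `F` is finite and free of degree `|I|`, let `F_* E` be
the direct sum of summands `N i`, `i : I`, such that multiplication by suitable functions upstairs
embeds any of them into any other. Then the rank of every `N i` over `U` is that of `E`. -/
lemma finrank_summand_of_pushforward {P Q : Scheme.{u}} (F : P ⟶ Q) {E : P.Modules} (U : Q.Opens)
    [IsDomain Γ(Q, U)] [IsDomain Γ(P, F ⁻¹ᵁ U)] [Module.Finite Γ(P, F ⁻¹ᵁ U) Γ(E, F ⁻¹ᵁ U)]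
    [Module.Projective Γ(P, F ⁻¹ᵁ U) Γ(E, F ⁻¹ᵁ U)] {I : Type*} [Fintype I]
    (hF : letI := (F.app U).hom.toAlgebra
      Module.Free Γ(Q, U) Γ(P, F ⁻¹ᵁ U) ∧ Module.Finite Γ(Q, U) Γ(P, F ⁻¹ᵁ U) ∧
        Module.finrank Γ(Q, U) Γ(P, F ⁻¹ᵁ U) = Fintype.card I)
    {N : I → Q.Modules} {ι : ∀ i, N i ⟶ (pushforward F).obj E}
    {π : ∀ i, (pushforward F).obj E ⟶ N i} (h₁ : ∀ i, ι i ≫ π i = 𝟙 _)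
    (h₀ : ∀ i j, i ≠ j → ι i ≫ π j = 0) (h : ∑ i, π i ≫ ι i = 𝟙 _)
    (hy : ∀ i j, ∃ y : Γ(P, F ⁻¹ᵁ U), y ≠ 0 ∧ ∀ t ∈ Set.range ((ι i).app U),
      y • t ∈ Set.range ((ι j).app U)) (i : I) :
    Module.Finite Γ(Q, U) Γ(N i, U) ∧ Module.Projective Γ(Q, U) Γ(N i, U) ∧
      Module.finrank Γ(Q, U) Γ(N i, U) = Module.finrank Γ(P, F ⁻¹ᵁ U) Γ(E, F ⁻¹ᵁ U) := by
  let := (F.app U).hom.toAlgebra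
  obtain ⟨_, _, hcard⟩ := hF
  let : Module Γ(Q, U) Γ(E, F ⁻¹ᵁ U) :=
    (inferInstance : Module Γ(Q, U) Γ((pushforward F).obj E, U))
  have : IsScalarTower Γ(Q, U) Γ(P, F ⁻¹ᵁ U) Γ(E, F ⁻¹ᵁ U) := ⟨fun r y t ↦ by
    rw [Algebra.smul_def, mul_smul]
    rfl⟩
  have h₁' (i) (x : Γ(N i, U)) : (π i).app U ((ι i).app U x) = x :=
    ConcreteCategory.congr_hom (congrArg (fun f ↦ f.app U) (h₁ i)) x
  have h₀' (i j) (hij : i ≠ j) (x : Γ(N i, U)) : (π j).app U ((ι i).app U x) = 0 :=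
    ConcreteCategory.congr_hom (congrArg (fun f ↦ f.app U) (h₀ i j hij)) x
  refine finrank_eq_of_isInternal (R := Γ(Q, U)) (S := Γ(P, F ⁻¹ᵁ U)) (P := Γ(E, F ⁻¹ᵁ U))
    hcard.symm (fun i ↦ Γ(N i, U)) (fun i ↦ appLinear (ι i) U) (fun i ↦ appLinear (π i) U)
    h₁' h₀' (fun x ↦ ?_) (fun i j ↦ ?_) i
  · let := endModule ((pushforward F).obj E) U
    have h₂ := Finset.sum_smul (R := End ((pushforward F).obj E)) (f := fun i ↦ π i ≫ ι i)
      (s := Finset.univ) (x := (show Γ((pushforward F).obj E, U) from x))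
    exact h₂.symm.trans (ConcreteCategory.congr_hom (congrArg (fun f ↦ f.app U) h) x)
  · obtain ⟨y, hy0, hy⟩ := hy i j
    let μ : Γ(E, F ⁻¹ᵁ U) →ₗ[Γ(Q, U)] Γ(E, F ⁻¹ᵁ U) :=
      (LinearMap.lsmul Γ(P, F ⁻¹ᵁ U) Γ(E, F ⁻¹ᵁ U) y).restrictScalars Γ(Q, U)
    refine ⟨appLinear (π j) U ∘ₗ μ ∘ₗ appLinear (ι i) U, (injective_iff_map_eq_zero _).mpr
      fun x hx ↦ ?_⟩
    obtain ⟨t, ht⟩ := hy _ ⟨x, rfl⟩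
    have hx' : (π j).app U ((ι j).app U t) = 0 := (congrArg ((π j).app U) ht).trans hx
    rw [h₁'] at hx'
    rw [hx', map_zero] at ht
    have hx'' : (ι i).app U x = 0 := (smul_eq_zero (R := Γ(P, F ⁻¹ᵁ U))
      (M := Γ(E, F ⁻¹ᵁ U)).mp ht.symm).resolve_left hy0
    rw [← h₁' i x, hx'', map_zero]

end Summands

section MuPow

open Scheme.Modules

attribute [local instance] pushforwardModule

variable {k : Type u} [Field k] {n m : ℕ}

/-- A constant, as a global regular function on projective space. -/
noncomputable def constGlobal (n : ℕ) (k : Type u) [Field k] : k →+* Γ(ProjSpace n k, ⊤) :=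
  ((Scheme.ΓSpecIso (.of k)).inv ≫ (ProjSpace.toSpec n k).appTop).hom

lemma resTop_constGlobal (c : k) (U : (ProjSpace n k).Opens) :
    resTop U (constGlobal n k c) = ProjSpace.const c U := rfl

lemma hasEnoughRootsOfUnity_muPow [IsAlgClosed k] (hchar : (m : k) ≠ 0) :
    HasEnoughRootsOfUnity k (Monoid.exponent (MuPow n k m)) := by
  have h : Monoid.exponent (MuPow n k m) ∣ m := by
    refine Monoid.exponent_dvd_of_forall_pow_eq_one fun g ↦ funext fun l ↦ Subtype.ext ?_
    simpa using (mem_rootsOfUnity m _).mp (g l).2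
  obtain ⟨c, hc⟩ := h
  have : NeZero ((Monoid.exponent (MuPow n k m) : ℕ) : k) := ⟨fun h0 ↦ hchar (by
    rw [hc, Nat.cast_mul, h0, zero_mul])⟩
  infer_instance

lemma natCard_muPow [IsAlgClosed k] (hchar : (m : k) ≠ 0) : Nat.card (MuPow n k m) = m ^ n := by
  have : NeZero (m : k) := ⟨hchar⟩
  have : NeZero m := .of_neZero_natCast k
  rw [Nat.card_fun, HasEnoughRootsOfUnity.natCard_rootsOfUnity, Nat.card_fin]

instance finite_muPow [NeZero m] : Finite (MuPow n k m) := Pi.finite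

variable {E : (ProjSpace n k).Modules} (L : Linearization E) (hm : 0 < m)

lemma Linearization.muAction_smul (g : MuPow n k m) (U : (ProjSpace n k).Opens)
    (hU : toricFrobenius n k m hm ⁻¹ᵁ U ≤
      translate g.toPoint ⁻¹ᵁ toricFrobenius n k m hm ⁻¹ᵁ U)
    (y : Γ(ProjSpace n k, toricFrobenius n k m hm ⁻¹ᵁ U))
    (s : Γ((pushforward (toricFrobenius n k m hm)).obj E, U)) :
    (L.muAction hm g).app U (y • s) =
      (translate g.toPoint).appLE _ _ hU y • (L.muAction hm g).app U s := by
  rw [Linearization.muAction_eq]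
  exact pushforwardEnd_smul (translate_toricFrobenius hm g) (transpose (L.atPoint g.toPoint))
    U hU y s

/-- Multiplication by an eigenfunction of weight `ψ` shifts the isotypic components of the sections
of `F_* E` over a chart by `ψ`. -/
lemma Linearization.muAction_eigenfunction_smul [Infinite k] {i : Fin (n + 1)}
    {ψ χ χ' : MuPow n k m →* kˣ} (hχ : χ' = ψ * χ)
    {y : Γ(ProjSpace n k, toricFrobenius n k m hm ⁻¹ᵁ standardChart i)}
    (hy : ∀ g : MuPow n k m,
      (translate g.toPoint).appLE _ _ (frobeniusChart_le_preimage_translate hm i g) y =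
        ProjSpace.const (ψ g : k) _ * y)
    {s : Γ((pushforward (toricFrobenius n k m hm)).obj E, standardChart i)}
    (hs : ∀ g, (L.muAction hm g).app (standardChart i) s =
      ProjSpace.const (χ g : k) (standardChart i) • s)
    (g : MuPow n k m) :
    (L.muAction hm g).app (standardChart i) (y • s) =
      ProjSpace.const (χ' g : k) (standardChart i) • y • s := by
  have hconst (c : k) (t : Γ((pushforward (toricFrobenius n k m hm)).obj E, standardChart i)) :
      ProjSpace.const c (standardChart i) • t =
        ProjSpace.const c (toricFrobenius n k m hm ⁻¹ᵁ standardChart i) • t := by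
    rw [← toricFrobenius_app_const]
    rfl
  have hmul : ProjSpace.const (χ' g : k) (toricFrobenius n k m hm ⁻¹ᵁ standardChart i) =
      ProjSpace.const (ψ g : k) _ * ProjSpace.const (χ g : k) _ := by
    rw [hχ, MonoidHom.mul_apply, Units.val_mul, ← resTop_constGlobal, map_mul, map_mul]
    rfl
  refine (L.muAction_smul hm g _ (frobeniusChart_le_preimage_translate hm i g) y s).trans ?_
  rw [hs g, hconst, hconst, hmul]
  refine (congrArg (· • _) (hy g)).trans ?_
  rw [smul_smul, smul_smul]
  congr 1
  ring

end MuPow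

end ToricFrobenius

namespace ToricFrobenius

section Rank

open Scheme.Modules

variable {k : Type u} [Field k] {n m : ℕ}

attribute [local instance] pushforwardModule

/-- If the summands of `F_* E` are its isotypic components, they all have the rank of `E`. -/
lemma Linearization.isVectorBundleOfRank_isotypic [Infinite k] {E : (ProjSpace n k).Modules}
    (L : Linearization E) (hm : 0 < m) {r : ℕ} (hE : IsVectorBundle E)
    (hr : IsVectorBundleOfRank E r)
    [Fintype (MuPow n k m →* kˣ)] (hcard : Fintype.card (MuPow n k m →* kˣ) = m ^ n)
    {N : (MuPow n k m →* kˣ) → (ProjSpace n k).Modules}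
    {ι : ∀ χ, N χ ⟶ (pushforward (toricFrobenius n k m hm)).obj E}
    {π : ∀ χ, (pushforward (toricFrobenius n k m hm)).obj E ⟶ N χ} (h₁ : ∀ χ, ι χ ≫ π χ = 𝟙 _)
    (h₀ : ∀ χ ψ, χ ≠ ψ → ι χ ≫ π ψ = 0) (h : ∑ χ, π χ ≫ ι χ = 𝟙 _)
    (hι : ∀ χ (U : (ProjSpace n k).Opens), Set.range ((ι χ).app U) =
      {s | ∀ g : MuPow n k m, (L.muAction hm g).app U s = ProjSpace.const (χ g : k) U • s})
    (χ : MuPow n k m →* kˣ) : IsVectorBundleOfRank (N χ) r := by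
  intro x
  obtain ⟨i, hi⟩ := exists_mem_standardChart x
  have hU := isAffineOpen_standardChart (n := n) (k := k) i
  have hV := isAffineOpen_frobeniusChart (n := n) (k := k) hm i
  have : IsDomain Γ(ProjSpace n k, standardChart i) :=
    (RingEquiv.ofBijective _ (bijective_standardChartCoord i)).toMulEquiv.isDomain _
  have : IsDomain Γ(ProjSpace n k, toricFrobenius n k m hm ⁻¹ᵁ standardChart i) :=
    (RingEquiv.ofBijective _ (bijective_frobeniusChartCoord hm i)).toMulEquiv.isDomain _
  have hq := hE.isQCohAt hV
  obtain ⟨_, _, hrank⟩ := finite_projective_sections hV hq fun y _ ↦ hr y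
  obtain ⟨hf₁, hf₂, hf₃⟩ := free_toricFrobenius_app (n := n) (k := k) hm i
  obtain ⟨_, _, hχ⟩ := finrank_summand_of_pushforward (toricFrobenius n k m hm) (E := E)
    (standardChart i) ⟨hf₁, hf₂, hf₃.trans hcard.symm⟩ h₁ h₀ h (fun χ χ' ↦ by
      obtain ⟨y, hy₀, hy⟩ := exists_eigenfunction hm i (χ' * χ⁻¹)
      refine ⟨y, hy₀, fun t ht ↦ ?_⟩
      rw [hι] at ht ⊢
      exact L.muAction_eigenfunction_smul hm (inv_mul_cancel_right χ' χ).symm hy ht) χ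
  have hqχ : IsQCohAt (N χ) (standardChart i) :=
    (hq.pushforward (toricFrobenius n k m hm)).of_retract (ι χ) (π χ) (h₁ χ)
  obtain ⟨W, hxW, e⟩ := exists_restrict_iso_freeModule hU hqχ hi
  rw [hχ, hrank] at e
  exact ⟨W, hxW, e⟩

end Rank

end ToricFrobenius

open ToricFrobenius
theorem mainTheorem4 {k : Type u} [Field k] [IsAlgClosed k] (n m : ℕ) (hm : 0 < m)
    (hchar : (m : k) ≠ 0) (E : (ProjSpace n k).Modules) (hE : IsVectorBundle E)
    (L : Linearization E) :
    Nat.card (MuPow n k m →* kˣ) = m ^ n ∧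
    (L.muAction hm 1 = 𝟙 _ ∧
      ∀ g h : MuPow n k m, L.muAction hm (g * h) = L.muAction hm g ≫ L.muAction hm h) ∧
    ∃ (r : ℕ) (Eχ : (MuPow n k m →* kˣ) → (ProjSpace n k).Modules)
      (ι : ∀ χ, Eχ χ ⟶ (Scheme.Modules.pushforward (toricFrobenius n k m hm)).obj E),
      IsVectorBundleOfRank E r ∧
      (∀ χ, IsVectorBundleOfRank (Eχ χ) r) ∧
      (∀ χ (U : (ProjSpace n k).Opens), Function.Injective ((ι χ).app U) ∧
        Set.range ((ι χ).app U) =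
          {s | ∀ g : MuPow n k m, (L.muAction hm g).app U s = ProjSpace.const (χ g : k) U • s}) ∧
      Nonempty (Limits.IsColimit (Limits.Cofan.mk _ ι)) := by
  have : NeZero m := ⟨hm.ne'⟩
  have : HasEnoughRootsOfUnity k (Monoid.exponent (MuPow n k m)) :=
    hasEnoughRootsOfUnity_muPow hchar
  have hcard : Nat.card (MuPow n k m) = m ^ n := natCard_muPow hchar
  have hcard' : Nat.card (MuPow n k m →* kˣ) = m ^ n := by
    rw [CommGroup.card_monoidHom_of_hasEnoughRootsOfUnity, hcard]
  refine ⟨hcard', ⟨L.muAction_one hm, L.muAction_mul hm⟩, ?_⟩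
  obtain ⟨r, hr⟩ := hE.exists_isVectorBundleOfRank
  obtain ⟨N, ι, π, h₁, h₀, hι, h, hcolim⟩ := exists_isotypic_decomposition
    ((Scheme.Modules.pushforward (toricFrobenius n k m hm)).obj E) (by
      rw [hcard, Nat.cast_pow]
      exact pow_ne_zero n hchar) (constGlobal n k) (L.muAction hm) (L.muAction_one hm)
    (L.muAction_mul hm)
  let := Fintype.ofFinite (MuPow n k m →* kˣ)
  refine ⟨r, N, ι, hr, L.isVectorBundleOfRank_isotypic hm hE hr
    (Nat.card_eq_fintype_card.symm.trans hcard') h₁ h₀ h hι, fun χ U ↦ ⟨?_, hι χ U⟩, hcolim⟩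
  exact Function.LeftInverse.injective (g := (π χ).app U) fun s ↦
    ConcreteCategory.congr_hom (congrArg (fun f ↦ Scheme.Modules.Hom.app f U) (h₁ χ)) s
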